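/- Let $a,b,c$ be positive integers. Project $\mathbb{R}^3$ to the plane along $(1,1,1)$, so that the coordinate directions $x,y,z$ point to the lower left, to the lower right and upwards, and let $H$ be the image of the box $[0,b]\times[0,a]\times[0,c]$, a hexagon with sides $a,b,c,a,b,c$ in the triangular lattice. A lozenge tiling of $H$ is a tiling of $H$ by lozenges (unions of two adjacent unit lattice triangles); the lozenges are of three types, called left, right and top tiles, the projections of unit squares orthogonal to the $x$-, $y$- and $z$-axis, respectively. Every lozenge tiling is the picture of a unique boxed plane partition, i.e. of a pile of unit cubes in the box, stacked against the floor and the two back walls. A left corner of a tiling consists of a top tile and a left tile that meet along an edge like the top and the left face of a cube, and its height in $\{1,\dots,c\}$ is the $z$-coordinate of its top tile in the pile of cubes. For a uniformly random lozenge tiling of $H$, let $\Gamma_\ell$ be the number of left corners of height $\ell$. For the rectangular partition $\rho=(a^b)$ ($b$ rows of length $a$) let $s_\rho$ be the Schur polynomial, and let $S_\rho(x_1,\dots,x_k;N)=s_\rho(x_1,\dots,x_k,1^{N-k})/s_\rho(1^N)$ be the normalized Schur polynomial. Then, for all $x_1,\dots,x_c\in\mathbb{C}$, $$\sum_{\gamma\in\mathbb{N}^c}\mathrm{P}(\Gamma_1=\gamma_1,\dots,\Gamma_c=\gamma_c)\,x_1^{\gamma_1}\cdots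 x_c^{\gamma_c}=S_\rho(x_1,\dots,x_c;b+c)=\frac{s_{(a^b)}(1^b,x_1,\dots,x_c)}{s_{(a^b)}(1^{b+c})}.$$ -/

import Mathlib

/-! ### The triangular lattice, lozenges, and the hexagon

The plane is `ℝ³` projected along `(1, 1, 1)`: the unit vectors `e_x, e_y, e_z` become plane vectors
with directions `210°, -30°, 90°` and `e_x + e_y + e_z = 0`. The lattice point `u e_x + v e_y` is
encoded as `(u, v) : ℤ × ℤ`, so that `e_z = (-1, -1)`. -/

/-- The projection of the point `(x, y, z)` of `ℤ³` to the triangular lattice. -/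
def proj (x y z : ℤ) : ℤ × ℤ := (x - z, y - z)

/-- The two kinds of unit triangles of the lattice (both have a vertical side). -/
inductive TriangleKind
  | pointsLeft
  | pointsRight

/-- A unit triangle of the triangular lattice, given by its kind and its uppermost vertex. -/
structure Triangle where
  kind : TriangleKind
  pos : ℤ × ℤ

/-- The vertices of a unit triangle: `p, p + e_x, p + e_x + e_y` or `p, p + e_y, p + e_x + e_y`. -/
def Triangle.vertices : Triangle → Set (ℤ × ℤ)
  | ⟨.pointsLeft, p⟩ => {p, p + (1, 0), p + (1, 1)}
  | ⟨.pointsRight, p⟩ => {p, p + (0, 1), p + (1, 1)}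

/-- The three types of lozenges. -/
inductive LozengeKind
  | left
  | top
  | right

/-- A lozenge. A top, left or right lozenge is the projection of a unit square of `ℝ³` orthogonal
to `e_z`, `e_x` or `e_y`; `pos` is the projection of the vertex of the square whose coordinates are
all maximal. Thus the lozenge has the vertices `pos`, `pos - e`, `pos - f`, `pos - e - f` with
`{e, f}` equal to `{e_x, e_y}`, `{e_y, e_z}`, `{e_x, e_z}`, respectively. -/
structure Lozenge where
  kind : LozengeKind
  pos : ℤ × ℤ

/-- The two adjacent unit triangles that make up a lozenge. -/
def Lozenge.triangles : Lozenge → Set Triangle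
  | ⟨.top, q⟩ => {⟨.pointsLeft, q - (1, 1)⟩, ⟨.pointsRight, q - (1, 1)⟩}
  | ⟨.left, q⟩ => {⟨.pointsLeft, q⟩, ⟨.pointsRight, q - (0, 1)⟩}
  | ⟨.right, q⟩ => {⟨.pointsLeft, q - (1, 0)⟩, ⟨.pointsRight, q⟩}

/-- The lattice points of the hexagon with sides `a, b, c, a, b, c`, which is the projection of the
box `[0, b] × [0, a] × [0, c]`. -/
def hexagonPoints (a b c : ℕ) : Set (ℤ × ℤ) :=
  {p | -(c : ℤ) ≤ p.1 ∧ p.1 ≤ b ∧ -(c : ℤ) ≤ p.2 ∧ p.2 ≤ a ∧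
    -(a : ℤ) ≤ p.1 - p.2 ∧ p.1 - p.2 ≤ b}

/-- The unit triangles contained in the hexagon. -/
def hexagon (a b c : ℕ) : Set Triangle :=
  {t | t.vertices ⊆ hexagonPoints a b c}

/-- The set `LT(a, b, c)` of lozenge tilings of the hexagon with sides `a, b, c, a, b, c`. -/
def lozengeTilings (a b c : ℕ) : Set (Finset Lozenge) :=
  {T | (∀ L ∈ T, L.triangles ⊆ hexagon a b c) ∧
    ∀ t ∈ hexagon a b c, ∃! L, L ∈ T ∧ t ∈ L.triangles}

/-- All events are measurable. -/
instance : MeasurableSpace (Finset Lozenge) := ⊤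

/-! ### Piles of cubes, left corners and their heights -/

/-- Plane partitions with at most `b` rows, at most `a` columns and entries at most `c`.
Rows and columns are numbered from `0`. -/
structure BoxedPlanePartition (a b c : ℕ) where
  entry : ℕ → ℕ → ℕ
  row_anti : ∀ i j, entry i (j + 1) ≤ entry i j
  col_anti : ∀ i j, entry (i + 1) j ≤ entry i j
  entry_le : entry 0 0 ≤ c
  rows_le : ∀ i j, b ≤ i → entry i j = 0
  cols_le : ∀ i j, a ≤ j → entry i j = 0

namespace BoxedPlanePartition

variable {a b c : ℕ}

/-- The height of the pile over the unit square `[i - 1, i] × [j - 1, j]` of the `xy`-plane, where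
`entry i j` cubes stand on `[i, i + 1] × [j, j + 1]` and the walls of height `c` behind the pile
are given by `i = 0` and `j = 0`. -/
def height (π : BoxedPlanePartition a b c) : ℕ → ℕ → ℕ
  | 0, _ => c
  | _ + 1, 0 => c
  | i + 1, j + 1 => π.entry i j

/-- The lozenges seen when the pile of cubes of `π`, standing in a box with a floor and two back
walls, is projected along `(1, 1, 1)`. -/
inductive IsVisible (π : BoxedPlanePartition a b c) : Lozenge → Prop
  | top (i j : ℕ) (hi : i < b) (hj : j < a) :
      IsVisible π ⟨.top, proj (i + 1) (j + 1) (π.entry i j)⟩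
  | left (i j k : ℕ) (hi : i ≤ b) (hj : j < a)
      (hk : π.height (i + 1) (j + 1) < k) (hk' : k ≤ π.height i (j + 1)) :
      IsVisible π ⟨.left, proj i (j + 1) k⟩
  | right (i j k : ℕ) (hi : i < b) (hj : j ≤ a)
      (hk : π.height (i + 1) (j + 1) < k) (hk' : k ≤ π.height (i + 1) j) :
      IsVisible π ⟨.right, proj (i + 1) j k⟩

end BoxedPlanePartition

/-- `T` has a left corner at the lattice point `q`: a top tile and a left tile of `T` that together
look like the top and the left face of a cube (the front edge of the top tile on its left side is
the upper edge of the left tile). -/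
def IsLeftCorner (T : Finset Lozenge) (q : ℤ × ℤ) : Prop :=
  ⟨.top, q⟩ ∈ T ∧ ⟨.left, q⟩ ∈ T

/-- When `T` is viewed as the picture of a pile of cubes in the box, the top tile of `T` at `q` is
a top face of the pile with `z`-coordinate `h`. -/
def HasHeight (a b c : ℕ) (T : Finset Lozenge) (q : ℤ × ℤ) (h : ℕ) : Prop :=
  ∃ π : BoxedPlanePartition a b c, (∀ L, L ∈ T ↔ π.IsVisible L) ∧
    ∃ i j : ℕ, i < b ∧ j < a ∧ q = proj (i + 1) (j + 1) (π.entry i j) ∧ π.entry i j = h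

/-- The vector `(Γ_1, …, Γ_c)`, with `Γ_ℓ` the number of left corners of height `ℓ`;
the index `ℓ : Fin c` stands for the height `ℓ + 1`. -/
noncomputable def cornerCount (a b c : ℕ) (T : Finset Lozenge) (ℓ : Fin c) : ℕ :=
  Set.ncard {q | IsLeftCorner T q ∧ HasHeight a b c T q (ℓ + 1)}

/-! ### Schur polynomials -/

/-- Semistandard Young tableaux of shape `μ` with entries in `{0, …, n - 1}`. -/
def BoundedSSYT (μ : YoungDiagram) (n : ℕ) : Type :=
  {T : SemistandardYoungTableau μ // ∀ c ∈ μ.cells, T c.1 c.2 < n}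

/-- The entry of a bounded tableau in a cell of its shape. -/
def BoundedSSYT.entry {μ : YoungDiagram} {n : ℕ} (T : BoundedSSYT μ n) (c : μ.cells) : Fin n :=
  ⟨T.1 c.1.1 c.1.2, T.2 c.1 c.2⟩

instance (μ : YoungDiagram) (n : ℕ) : Finite (BoundedSSYT μ n) := by
  refine Finite.of_injective (fun T : BoundedSSYT μ n => T.entry) fun S T h => Subtype.ext ?_
  ext i j
  by_cases hc : (i, j) ∈ μ.cells
  · exact congrArg Fin.val (congrFun h ⟨(i, j), hc⟩)
  · rw [S.1.zeros (by simpa using hc), T.1.zeros (by simpa using hc)]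

noncomputable instance (μ : YoungDiagram) (n : ℕ) : Fintype (BoundedSSYT μ n) :=
  Fintype.ofFinite _

/-- The Schur polynomial `s_μ` in `n` variables, evaluated at `x`. -/
noncomputable def schur (μ : YoungDiagram) {n : ℕ} (x : Fin n → ℂ) : ℂ :=
  ∑ T : BoundedSSYT μ n, ∏ c : μ.cells, x (T.entry c)

/-- The normalized Schur polynomial `s_μ(x_1, …, x_k, 1^{N - k}) / s_μ(1^N)`, for `k ≤ N`. -/
noncomputable def normalizedSchur (μ : YoungDiagram) {k : ℕ} (x : Fin k → ℂ) (N : ℕ) : ℂ :=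
  schur μ (fun i : Fin N => if h : (i : ℕ) < k then x ⟨i, h⟩ else 1) /
    schur μ (fun _ : Fin N => 1)

/-- The rectangular partition `(a^b)`: `b` rows of length `a`. -/
def rectangle (a b : ℕ) : YoungDiagram where
  cells := Finset.range b ×ˢ Finset.range a
  isLowerSet := by
    rintro ⟨i, j⟩ ⟨i', j'⟩ ⟨hi, hj⟩ h
    simp only [Finset.coe_product, Finset.coe_range, Set.mem_prod, Set.mem_Iio] at h ⊢
    exact ⟨lt_of_le_of_lt hi h.1, lt_of_le_of_lt hj h.2⟩

/-! Everything is reduced to matrix elements, between the empty partition and the full rectangle, of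
products of transfer matrices on partitions in a box. Turned by 180 degrees, a boxed plane partition
π is the chain of its sublevel sets {π < m}, a chain of c + 1 arbitrary inclusions. A left corner of
height ℓ is an entry ℓ whose neighbour in the next row is smaller; in the chain it is an uppermost
new cell of a column in the step that adds the entries ℓ. So the generating function is an element
of a product of `growth a b b` matrices (`sum_prod_corners`). A tableau of rectangular shape is a
chain of horizontal strips, so the Schur polynomial is the same element of a product of `strip`
matrices (`schur_rectangle`).

The matrices `growth a b k` interpolate between arbitrary growth (k = b) and horizontal strips (k ≤
1). The key is the exchange relation `tailStrip_mul_growth`: a strip below row k passes through a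
growth step and changes its index from k + 1 to k. It is proved by reflecting each intermediate part
in its interval of possible values, as in a Bender–Knuth involution. For k ≥ 1 a tail strip cannot
start at the empty partition, and near the rectangle it is the same as a full strip. Hence lowering
the index once costs one factor `strip a b t` at the right end, and going from b to 1 costs b - 1 of
them. With t = 1 and the step that adds the entries 0, there are b strips of weight 1 besides those
of weights x_1, …, x_c. The relation at k = 0 says that strips commute, which gives the symmetry;
putting all x_ℓ = 1 gives the denominator.

Tilings are matched with plane partitions by height functions. The lozenge that covers a triangle
crosses exactly one of its sides, and this is the condition for the height increments to add up
around the triangle. Height functions of tilings and of piles obey the same rules, and the top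
lozenges determine them. -/

/-! ### Partitions in a box and transfer matrices -/

/-- Partitions with at most `b` parts of size at most `a`. The parts are `f 1 ≥ f 2 ≥ ⋯ ≥ f b`;
the value `f 0 = a` plays the role of an infinite zeroth part. -/
def BoxPartition (a b : ℕ) : Type :=
  {f : ℕ → ℕ // Antitone f ∧ f 0 = a ∧ ∀ i, b < i → f i = 0}

namespace BoxPartition

variable {a b : ℕ}

instance : CoeFun (BoxPartition a b) fun _ => ℕ → ℕ := ⟨Subtype.val⟩

theorem ext_parts {μ ν : BoxPartition a b} (h : ∀ i, μ i = ν i) : μ = ν := Subtype.ext (funext h)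

theorem zero_eq (μ : BoxPartition a b) : μ 0 = a := μ.2.2.1

theorem anti (μ : BoxPartition a b) {i j : ℕ} (h : i ≤ j) : μ j ≤ μ i := μ.2.1 h

theorem succ_le (μ : BoxPartition a b) (i : ℕ) : μ (i + 1) ≤ μ i := μ.2.1 (Nat.le_succ i)

theorem le_width (μ : BoxPartition a b) (i : ℕ) : μ i ≤ a :=
  (μ.anti (Nat.zero_le i)).trans_eq μ.zero_eq

theorem eq_zero (μ : BoxPartition a b) {i : ℕ} (h : b < i) : μ i = 0 := μ.2.2.2 i h

instance : Finite (BoxPartition a b) := by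
  refine Finite.of_injective
    (fun (μ : BoxPartition a b) (i : Fin (b + 1)) =>
      (⟨μ i, Nat.lt_succ_of_le (μ.le_width i)⟩ : Fin (a + 1))) fun μ ν h => ext_parts fun i => ?_
  by_cases hi : i < b + 1
  · simpa using congrFun h ⟨i, hi⟩
  · rw [μ.eq_zero (by omega), ν.eq_zero (by omega)]

noncomputable instance : Fintype (BoxPartition a b) := Fintype.ofFinite _

noncomputable instance : DecidableEq (BoxPartition a b) := Classical.decEq _

/-- The empty partition. -/
def empty (a b : ℕ) : BoxPartition a b :=
  ⟨fun i => if i = 0 then a else 0,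
    antitone_nat_of_succ_le fun i => by simp, by simp, fun i hi => by simp; omega⟩

/-- The rectangular partition with `b` parts `a`. -/
def full (a b : ℕ) : BoxPartition a b :=
  ⟨fun i => if i ≤ b then a else 0,
    antitone_nat_of_succ_le fun i => by split_ifs <;> omega, by simp,
    fun i hi => by simp; omega⟩

theorem empty_succ (i : ℕ) : empty a b (i + 1) = 0 := rfl

theorem full_of_le {i : ℕ} (h : i ≤ b) : full a b i = a := if_pos h

variable {R : Type*} [CommSemiring R]

/-- `λ` is obtained from `ν` by adding cells, at most one in each column below the row `k`. -/
def Extends (k : ℕ) (ν lam : BoxPartition a b) : Prop :=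
  (∀ i, ν i ≤ lam i) ∧ ∀ i, k ≤ i → lam (i + 1) ≤ ν i

/-- `λ` is obtained from `ν` by adding a horizontal strip in the rows below the row `k`. -/
def TailExtends (k : ℕ) (ν lam : BoxPartition a b) : Prop :=
  (∀ i, i ≤ k → lam i = ν i) ∧ ∀ i, k ≤ i → ν (i + 1) ≤ lam (i + 1) ∧ lam (i + 1) ≤ ν i

/-- The number of nonempty columns of `λ / ν`, or the number of cells of `λ / ν` without a cell of
`λ / ν` above them. -/
def topCells (ν lam : BoxPartition a b) : ℕ :=
  ∑ i ∈ Finset.range b, (min (lam (i + 1)) (ν i) - ν (i + 1))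

/-- The number of cells of `λ / ν` below another cell of `λ / ν`. -/
def lowerCells (ν lam : BoxPartition a b) : ℕ := ∑ i ∈ Finset.range b, (lam (i + 1) - ν i)

/-- The number of cells of `λ / ν`. -/
def numCells (ν lam : BoxPartition a b) : ℕ := ∑ i ∈ Finset.range b, (lam (i + 1) - ν (i + 1))

open Classical in
/-- The transfer matrix that adds cells, at most one in each column below the row `k`, with
weight `x` for the uppermost new cell of a column and weight `t` for the others. -/
noncomputable def growth (a b k : ℕ) (x t : R) : Matrix (BoxPartition a b) (BoxPartition a b) R :=
  fun ν lam => if Extends k ν lam then x ^ topCells ν lam * t ^ lowerCells ν lam else 0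

open Classical in
/-- The transfer matrix that adds a horizontal strip below the row `k`. -/
noncomputable def tailStrip (a b k : ℕ) (t : R) :
    Matrix (BoxPartition a b) (BoxPartition a b) R :=
  fun ν lam => if TailExtends k ν lam then t ^ numCells ν lam else 0

/-- The reflection of `μ` in the range of possible intermediate partitions between `ν` and `λ`
below the row `k`; in the rows up to `k` the result agrees with `f`. -/
def reflectFun (k : ℕ) (f ν lam μ : ℕ → ℕ) : ℕ → ℕ
  | 0 => f 0
  | i + 1 => if i + 1 ≤ k then f (i + 1)
      else max (ν (i + 1)) (lam (i + 1 + 1)) + min (ν i) (lam (i + 1)) - μ (i + 1)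

theorem reflectFun_of_le {k : ℕ} {f ν lam μ : ℕ → ℕ} {i : ℕ} (h : i ≤ k) :
    reflectFun k f ν lam μ i = f i := by
  cases i with
  | zero => rfl
  | succ i => simp [reflectFun, h]

theorem reflectFun_of_ge {k : ℕ} {f ν lam μ : ℕ → ℕ} {i : ℕ} (h : k ≤ i) :
    reflectFun k f ν lam μ (i + 1) =
      max (ν (i + 1)) (lam (i + 1 + 1)) + min (ν i) (lam (i + 1)) - μ (i + 1) := by
  simp [reflectFun]; omega

/-- The possible intermediate parts between `ν` and `λ` below the row `k`. -/
def Between (k : ℕ) (ν lam : BoxPartition a b) (μ : ℕ → ℕ) : Prop :=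
  ∀ i, k ≤ i → max (ν (i + 1)) (lam (i + 1 + 1)) ≤ μ (i + 1) ∧ μ (i + 1) ≤ min (ν i) (lam (i + 1))

theorem Between.reflect {k : ℕ} {ν lam : BoxPartition a b} {μ : ℕ → ℕ}
    (h : Between k ν lam μ) (f : ℕ → ℕ) : Between k ν lam (reflectFun k f ν lam μ) := by
  intro i hi
  have := h i hi
  rw [reflectFun_of_ge hi]
  omega

/-- The reflected partition. -/
def reflect (k : ℕ) (f ν lam : BoxPartition a b) (hf : f = ν ∨ f = lam) (μ : BoxPartition a b)
    (h : Between k ν lam μ) : BoxPartition a b :=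
  ⟨reflectFun k f ν lam μ, by
    have hb := h.reflect f
    refine ⟨antitone_nat_of_succ_le fun i => ?_, ?_, fun i hi => ?_⟩
    · rcases lt_trichotomy i k with hik | rfl | hik
      · rw [reflectFun_of_le hik.le, reflectFun_of_le hik]
        exact f.succ_le i
      · rw [reflectFun_of_le le_rfl]
        -- The reflected part k + 1 is at most ν_k and at most λ_{k+1} ≤ λ_k, so it fits below
        -- either choice of `f`.
        have h1 := (hb i le_rfl).2
        have h2 := lam.succ_le i
        rcases hf with rfl | rfl <;> omega
      · obtain ⟨j, rfl⟩ : ∃ j, i = j + 1 := ⟨i - 1, by omega⟩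
        have h1 := (hb (j + 1) (by omega)).2
        have h2 := (hb j (by omega)).1
        omega
    · rw [reflectFun_of_le (Nat.zero_le k)]
      exact f.zero_eq
    · obtain ⟨j, rfl⟩ : ∃ j, i = j + 1 := ⟨i - 1, by omega⟩
      by_cases hjk : j + 1 ≤ k
      · rw [reflectFun_of_le hjk]
        exact f.eq_zero hi
      · have h1 := (hb j (by omega)).2
        have h2 := lam.eq_zero hi
        omega⟩

theorem reflect_of_le {k : ℕ} {f ν lam : BoxPartition a b} {hf : f = ν ∨ f = lam}
    {μ : BoxPartition a b} {h : Between k ν lam μ} {i : ℕ} (hi : i ≤ k) :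
    reflect k f ν lam hf μ h i = f i := reflectFun_of_le hi

theorem reflect_of_ge {k : ℕ} {f ν lam : BoxPartition a b} {hf : f = ν ∨ f = lam}
    {μ : BoxPartition a b} {h : Between k ν lam μ} {i : ℕ} (hi : k ≤ i) :
    reflect k f ν lam hf μ h (i + 1) =
      max (ν (i + 1)) (lam (i + 1 + 1)) + min (ν i) (lam (i + 1)) - μ (i + 1) := reflectFun_of_ge hi

theorem between_reflect {k : ℕ} {f ν lam : BoxPartition a b} {hf : f = ν ∨ f = lam}
    {μ : BoxPartition a b} {h : Between k ν lam μ} :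
    Between k ν lam (reflect k f ν lam hf μ h) := h.reflect f

/-- Both orders of the two steps leave the same interval for each part below row k. They differ only
in whether the rows up to k are still those of ν or already those of λ, so a reflection below row k
can match them. -/
theorem tailExtends_and_extends_iff {k : ℕ} {ν lam μ : BoxPartition a b} :
    TailExtends k ν μ ∧ Extends (k + 1) μ lam ↔
      (∀ i, ν i ≤ lam i) ∧ (∀ i, i ≤ k → μ i = ν i) ∧ Between k ν lam μ := by
  refine ⟨fun ⟨⟨h1, h2⟩, h3, h4⟩ => ⟨fun i => ?_, h1, fun i hi => ?_⟩, 
    fun ⟨h1, h2, h3⟩ => ⟨⟨h2, fun i hi => ?_⟩, fun i => ?_, fun i hi => ?_⟩⟩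
  · by_cases hi : i ≤ k
    · exact h1 i hi ▸ h3 i
    · obtain ⟨j, rfl⟩ : ∃ j, i = j + 1 := ⟨i - 1, by omega⟩
      exact (h2 j (by omega)).1.trans (h3 _)
  · have := h2 i hi
    have := h4 (i + 1) (by omega)
    have := h3 (i + 1)
    omega
  · have := h3 i hi
    omega
  · by_cases hi : i ≤ k
    · exact (h2 i hi).symm ▸ h1 i
    · obtain ⟨j, rfl⟩ : ∃ j, i = j + 1 := ⟨i - 1, by omega⟩
      have := h3 j (by omega)
      omega
  · obtain ⟨j, rfl⟩ : ∃ j, i = j + 1 := ⟨i - 1, by omega⟩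
    have := h3 j (by omega)
    omega

theorem extends_and_tailExtends_iff {k : ℕ} {ν lam μ : BoxPartition a b} :
    Extends k ν μ ∧ TailExtends k μ lam ↔
      (∀ i, ν i ≤ lam i) ∧ (∀ i, i ≤ k → μ i = lam i) ∧ Between k ν lam μ := by
  refine ⟨fun ⟨⟨h3, h4⟩, h1, h2⟩ => ⟨fun i => ?_, fun i hi => (h1 i hi).symm, fun i hi => ?_⟩,
    fun ⟨h1, h2, h3⟩ => ⟨⟨fun i => ?_, fun i hi => ?_⟩, fun i hi => (h2 i hi).symm, fun i hi => ?_⟩⟩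
  · by_cases hi : i ≤ k
    · exact (h1 i hi).symm ▸ h3 i
    · obtain ⟨j, rfl⟩ : ∃ j, i = j + 1 := ⟨i - 1, by omega⟩
      exact (h3 _).trans (h2 j (by omega)).1
  · have := h2 i hi
    have := h2 (i + 1) (by omega)
    have := h4 i hi
    have := h3 (i + 1)
    omega
  · by_cases hi : i ≤ k
    · exact (h2 i hi).symm ▸ h1 i
    · obtain ⟨j, rfl⟩ : ∃ j, i = j + 1 := ⟨i - 1, by omega⟩
      have := h3 j (by omega)
      omega
  · have := h3 i hi
    omega
  · refine ⟨(h3 i hi).2.trans (min_le_right _ _), ?_⟩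
    rcases hi.eq_or_lt with rfl | hi
    · exact h2 k le_rfl ▸ lam.succ_le k
    · obtain ⟨j, rfl⟩ : ∃ j, i = j + 1 := ⟨i - 1, by omega⟩
      have := h3 j (by omega)
      omega


/-- Row by row the exponents differ by increments of `G`, with opposite signs for the two weights;
only the totals agree. -/
theorem reflect_exponents {k : ℕ} {ν lam μ μ' : BoxPartition a b}
    (h1 : ∀ i, i ≤ k → μ i = ν i) (h2 : ∀ i, i ≤ k → μ' i = lam i) (hb : Between k ν lam μ)
    (h3 : ∀ i, k ≤ i → μ' (i + 1) + μ (i + 1) =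
      max (ν (i + 1)) (lam (i + 1 + 1)) + min (ν i) (lam (i + 1))) :
    topCells μ lam = topCells ν μ' ∧
      numCells ν μ + lowerCells μ lam = lowerCells ν μ' + numCells μ' lam := by
  -- Below row k, `-G i` counts the cells of λ / ν in row i + 1 that lie below another cell of λ /
  -- ν. It vanishes at i = b because λ has no part b + 1.
  let G : ℕ → ℤ := fun i => if i ≤ k then 0 else min (ν i : ℤ) (lam (i + 1)) - lam (i + 1)
  have hG : G b - G 0 = 0 := by
    have : (lam (b + 1) : ℤ) = 0 := by exact_mod_cast lam.eq_zero (Nat.lt_succ_self b)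
    simp only [G, this]
    simp
  have htel : ∑ i ∈ Finset.range b, (G (i + 1) - G i) = 0 := by
    rw [Finset.sum_range_sub, hG]
  have key : ∀ i, ((min (lam (i + 1)) (μ i) - μ (i + 1) : ℕ) : ℤ) =
        ((min (μ' (i + 1)) (ν i) - ν (i + 1) : ℕ) : ℤ) + (G (i + 1) - G i) ∧
      ((μ (i + 1) - ν (i + 1) : ℕ) : ℤ) + ((lam (i + 1) - μ i : ℕ) : ℤ) =
        ((μ' (i + 1) - ν i : ℕ) : ℤ) + ((lam (i + 1) - μ' (i + 1) : ℕ) : ℤ) -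
          (G (i + 1) - G i) := by
    intro i
    rcases lt_trichotomy i k with hik | rfl | hik
    · have e1 : G (i + 1) = 0 := if_pos hik
      have e2 : G i = 0 := if_pos hik.le
      rw [e1, e2, h1 i hik.le, h1 (i + 1) hik, h2 (i + 1) hik]
      simp
    · have e1 : G (i + 1) = _ := if_neg (by omega)
      have e2 : G i = 0 := if_pos le_rfl
      rw [e1, e2, h1 i le_rfl]
      have := h3 i le_rfl
      have := hb i le_rfl
      omega
    · obtain ⟨j, rfl⟩ : ∃ j, i = j + 1 := ⟨i - 1, by omega⟩
      have e1 : G (j + 1 + 1) = _ := if_neg (by omega)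
      have e2 : G (j + 1) = _ := if_neg (by omega)
      rw [e1, e2]
      have := h3 (j + 1) (by omega)
      have := hb (j + 1) (by omega)
      have := hb j (by omega)
      omega
  constructor
  · zify [topCells]
    rw [Finset.sum_congr rfl fun i _ => (key i).1, Finset.sum_add_distrib, htel, add_zero]
  · zify [numCells, lowerCells]
    rw [← Finset.sum_add_distrib, Finset.sum_congr rfl fun i _ => (key i).2,
      Finset.sum_sub_distrib, htel, sub_zero, Finset.sum_add_distrib]

/-- The exchange relation for the two kinds of transfer matrices. -/
theorem tailStrip_mul_growth (k : ℕ) (x t : R) :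
    tailStrip a b k t * growth a b (k + 1) x t = growth a b k x t * tailStrip a b k t := by
  classical
  ext ν lam
  simp only [Matrix.mul_apply, tailStrip, growth, ite_zero_mul_ite_zero]
  rw [← Finset.sum_filter, ← Finset.sum_filter]
  simp only [tailExtends_and_extends_iff, extends_and_tailExtends_iff]
  -- The reflection is its own inverse below row k; the rows up to k are exchanged between ν and λ.
  refine Finset.sum_bij'
    (fun μ hμ => reflect k lam ν lam (Or.inr rfl) μ (Finset.mem_filter.1 hμ).2.2.2)
    (fun μ hμ => reflect k ν ν lam (Or.inl rfl) μ (Finset.mem_filter.1 hμ).2.2.2)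
    ?_ ?_ ?_ ?_ ?_
  · intro μ hμ
    have h := (Finset.mem_filter.1 hμ).2
    exact Finset.mem_filter.2 ⟨Finset.mem_univ _, h.1, fun i hi => reflect_of_le hi,
      between_reflect⟩
  · intro μ hμ
    have h := (Finset.mem_filter.1 hμ).2
    exact Finset.mem_filter.2 ⟨Finset.mem_univ _, h.1, fun i hi => reflect_of_le hi,
      between_reflect⟩
  · intro μ hμ
    have h := (Finset.mem_filter.1 hμ).2
    refine ext_parts fun i => ?_
    by_cases hi : i ≤ k
    · rw [reflect_of_le hi, h.2.1 i hi]
    · obtain ⟨j, rfl⟩ : ∃ j, i = j + 1 := ⟨i - 1, by omega⟩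
      have := h.2.2 j (by omega)
      rw [reflect_of_ge (by omega), reflect_of_ge (by omega)]
      omega
  · intro μ hμ
    have h := (Finset.mem_filter.1 hμ).2
    refine ext_parts fun i => ?_
    by_cases hi : i ≤ k
    · rw [reflect_of_le hi, h.2.1 i hi]
    · obtain ⟨j, rfl⟩ : ∃ j, i = j + 1 := ⟨i - 1, by omega⟩
      have := h.2.2 j (by omega)
      rw [reflect_of_ge (by omega), reflect_of_ge (by omega)]
      omega
  · intro μ hμ
    have h := (Finset.mem_filter.1 hμ).2
    obtain ⟨e1, e2⟩ := reflect_exponents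
      (μ' := reflect k lam ν lam (Or.inr rfl) μ h.2.2) h.2.1 (fun i hi => reflect_of_le hi) h.2.2
      (fun i hi => by
        have := h.2.2 i hi
        rw [reflect_of_ge hi]
        omega)
    rw [← e1, mul_left_comm, ← pow_add, e2, mul_assoc, ← pow_add]

/-! ### Horizontal strips -/

/-- The transfer matrix that adds a horizontal strip. -/
noncomputable def strip (a b : ℕ) (x : R) : Matrix (BoxPartition a b) (BoxPartition a b) R :=
  tailStrip a b 0 x

theorem tailExtends_zero_iff {ν lam : BoxPartition a b} :
    TailExtends 0 ν lam ↔ ∀ i, ν (i + 1) ≤ lam (i + 1) ∧ lam (i + 1) ≤ ν i := by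
  refine ⟨fun h i => h.2 i (Nat.zero_le i), fun h => ⟨fun i hi => ?_, fun i _ => h i⟩⟩
  obtain rfl : i = 0 := by omega
  rw [ν.zero_eq, lam.zero_eq]

theorem extends_iff_of_le_one {k : ℕ} (hk : k ≤ 1) {ν lam : BoxPartition a b} :
    Extends k ν lam ↔ TailExtends 0 ν lam := by
  rw [tailExtends_zero_iff]
  refine ⟨fun h i => ⟨h.1 _, ?_⟩, fun h => ⟨fun i => ?_, fun i _ => (h i).2⟩⟩
  · rcases i with _ | i
    · rw [ν.zero_eq]
      exact lam.le_width _
    · exact h.2 _ (by omega)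
  · rcases i with _ | i
    · rw [ν.zero_eq, lam.zero_eq]
    · exact (h i).1

/-- The condition at row 0 is vacuous because the zeroth part is the full width, so k = 0 and k = 1
agree. In a horizontal strip no new cell lies below another, hence `t` disappears. -/
theorem growth_of_le_one {k : ℕ} (hk : k ≤ 1) (x t : R) : growth a b k x t = strip a b x := by
  ext ν lam
  by_cases h : TailExtends 0 ν lam
  · simp only [growth, strip, tailStrip, if_pos ((extends_iff_of_le_one hk).2 h), if_pos h]
    rw [tailExtends_zero_iff] at h
    have e1 : topCells ν lam = numCells ν lam :=
      Finset.sum_congr rfl fun i _ => by rw [min_eq_left (h i).2]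
    have e2 : lowerCells ν lam = 0 :=
      Finset.sum_eq_zero fun i _ => Nat.sub_eq_zero_of_le (h i).2
    rw [e1, e2, pow_zero, mul_one]
  · simp only [growth, strip, tailStrip, if_neg (mt (extends_iff_of_le_one hk).1 h), if_neg h]

/-- The exchange relation at k = 0, where all four factors are strips. -/
theorem strip_commute (x t : R) : Commute (strip a b x) (strip a b t) := by
  have := tailStrip_mul_growth (a := a) (b := b) 0 x t
  rw [growth_of_le_one le_rfl, growth_of_le_one zero_le_one] at this
  exact this.symm

/-- A new part below row k is at most the preceding part of the empty partition, which is 0 since k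
≥ 1 excludes the zeroth part. -/
theorem tailStrip_empty {k : ℕ} (hk : 1 ≤ k) (t : R) :
    tailStrip a b k t (empty a b) = Pi.single (empty a b) 1 := by
  classical
  ext lam
  have hiff : TailExtends k (empty a b) lam ↔ lam = empty a b := by
    refine ⟨fun h => ext_parts fun i => ?_, ?_⟩
    · by_cases hi : i ≤ k
      · exact h.1 i hi
      · obtain ⟨j, rfl⟩ : ∃ j, i = j + 1 + 1 := ⟨i - 2, by omega⟩
        have := (h.2 (j + 1) (by omega)).2
        rw [empty_succ] at this ⊢
        omega
    · rintro rfl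
      exact ⟨fun _ _ => rfl, fun i _ => ⟨le_rfl, succ_le _ i⟩⟩
  simp only [tailStrip, hiff, Pi.single_apply]
  split_ifs with h
  · subst h
    simp [numCells]
  · rfl

/-- If the first k + 1 rows of λ are full, a horizontal strip λ / ν forces ν_i ≥ λ_{i+1} = a for i ≤
k, so it lies below row k by itself. -/
theorem tailStrip_mulVec_eq_strip_mulVec {k : ℕ} {w : BoxPartition a b → R} (t : R)
    (hw : ∀ lam, w lam ≠ 0 → lam (k + 1) = a) :
    (tailStrip a b k t).mulVec w = (strip a b t).mulVec w := by
  classical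
  ext ν
  refine Finset.sum_congr rfl fun lam _ => ?_
  by_cases h0 : w lam = 0
  · simp [h0]
  have hlam : ∀ i, i ≤ k + 1 → lam i = a := fun i hi =>
    le_antisymm (lam.le_width i) ((hw lam h0).ge.trans (lam.anti hi))
  have : TailExtends k ν lam ↔ TailExtends 0 ν lam := by
    rw [tailExtends_zero_iff]
    refine ⟨fun h i => ?_, fun h => ⟨fun i hi => ?_, fun i _ => h i⟩⟩
    · by_cases hi : k ≤ i
      · exact h.2 i hi
      · rw [← h.1 i (by omega), ← h.1 (i + 1) (by omega)]
        exact ⟨le_rfl, lam.succ_le i⟩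
    · have h1 := (h i).2
      have h2 := hlam (i + 1) (by omega)
      have h3 := hlam i (by omega)
      have := ν.le_width i
      omega
  simp only [strip, tailStrip, this]

theorem strip_mulVec_support {k : ℕ} {w : BoxPartition a b → R} (t : R)
    (hw : ∀ lam, w lam ≠ 0 → lam (k + 1) = a) (ν : BoxPartition a b)
    (hν : (strip a b t).mulVec w ν ≠ 0) : ν k = a := by
  classical
  obtain ⟨lam, -, h⟩ := Finset.exists_ne_zero_of_sum_ne_zero hν
  have h1 : TailExtends 0 ν lam := by
    by_contra hn
    exact h (by simp [strip, tailStrip, hn])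
  have h2 := hw lam (right_ne_zero_of_mul h)
  have h3 := (tailExtends_zero_iff.1 h1 k).2
  have := ν.le_width k
  omega

theorem list_prod_growth_mul_tailStrip (k : ℕ) (t : R) (xs : List R) :
    tailStrip a b k t * (xs.map fun x => growth a b (k + 1) x t).prod =
      (xs.map fun x => growth a b k x t).prod * tailStrip a b k t := by
  induction xs with
  | nil => simp
  | cons x xs ih =>
    simp only [List.map_cons, List.prod_cons]
    rw [← mul_assoc, tailStrip_mul_growth, mul_assoc, ih, mul_assoc]

/-- The strip at the right end is a tail strip on the support of `w`; moved to the left through all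
growth steps, it raises their index to k + 1 and is absorbed by the empty partition. -/
theorem prod_growth_mulVec_empty {k : ℕ} (hk : 1 ≤ k) (t : R) (xs : List R)
    {w : BoxPartition a b → R} (hw : ∀ lam, w lam ≠ 0 → lam (k + 1) = a) :
    (xs.map fun x => growth a b (k + 1) x t).prod.mulVec w (empty a b) =
      (xs.map fun x => growth a b k x t).prod.mulVec ((strip a b t).mulVec w) (empty a b) := by
  rw [← tailStrip_mulVec_eq_strip_mulVec t hw, Matrix.mulVec_mulVec,
    ← list_prod_growth_mul_tailStrip, ← Matrix.mulVec_mulVec]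
  conv_rhs => rw [Matrix.mulVec, tailStrip_empty hk]
  simp

/-- The support is carried through the induction: taking m strips off the rectangle leaves the first
b - m rows full, as the next exchange requires. -/
theorem prod_growth_eq_prod_strip_mulVec (t : R) (xs : List R) (m k : ℕ) (hk : k + 1 + m = b) :
    (xs.map fun x => growth a b b x t).prod.mulVec (Pi.single (full a b) 1) (empty a b) =
        (xs.map fun x => growth a b (k + 1) x t).prod.mulVec
          ((strip a b t ^ m).mulVec (Pi.single (full a b) 1)) (empty a b) ∧
      ∀ lam, (strip a b t ^ m).mulVec (Pi.single (full a b) 1) lam ≠ 0 → lam (k + 1) = a := by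
  induction m generalizing k with
  | zero =>
    obtain rfl : k + 1 = b := by omega
    refine ⟨by rw [pow_zero, Matrix.one_mulVec], fun lam h => ?_⟩
    rw [pow_zero, Matrix.one_mulVec, Pi.single_apply] at h
    obtain rfl : lam = full a (k + 1) := by by_contra hn; simp [hn] at h
    exact full_of_le le_rfl
  | succ m ih =>
    obtain ⟨h1, h2⟩ := ih (k + 1) (by omega)
    rw [pow_succ', ← Matrix.mulVec_mulVec]
    refine ⟨?_, strip_mulVec_support t h2⟩
    rw [h1, prod_growth_mulVec_empty (by omega) t xs h2]

/-- Chains of arbitrary growth steps from the empty partition to the rectangle are equinumerous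
with chains of horizontal strips, if `b - 1` strips are added at the end. -/
theorem prod_growth_eq_prod_strip (hb : 0 < b) (t : R) (xs : List R) :
    (xs.map fun x => growth a b b x t).prod (empty a b) (full a b) =
      ((xs.map fun x => strip a b x).prod * strip a b t ^ (b - 1)) (empty a b) (full a b) := by
  -- At k = 0 the growth matrices have index 1 and are already strips, whence b - 1 and not b.
  have h := (prod_growth_eq_prod_strip_mulVec (a := a) t xs (b - 1) 0
    (by rw [zero_add, Nat.add_sub_cancel' hb])).1
  rw [Matrix.mulVec_mulVec] at h
  simpa [growth_of_le_one] using h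

end BoxPartition

/-! ### Chains of partitions and fillings of a rectangle -/

/-- Turns matrix products into sums over chains, the form in which tableaux and plane partitions are
matched with them. -/
theorem list_ofFn_prod_apply {S R : Type*} [Fintype S] [DecidableEq S] [CommSemiring R] {n : ℕ}
    (W : Fin n → Matrix S S R) (u v : S) :
    (List.ofFn W).prod u v = ∑ κ : Fin (n + 1) → S,
      if κ 0 = u ∧ κ (Fin.last n) = v then ∏ m : Fin n, W m (κ m.castSucc) (κ m.succ) else 0 := by
  induction n generalizing u with
  | zero =>
    rw [← (Equiv.funUnique (Fin 1) S).symm.sum_comp]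
    simp [Matrix.one_apply, Finset.filter_and, Finset.filter_eq, eq_comm]
    by_cases h : u = v
    · subst h
      simp
    · simp [h, Ne.symm h, Finset.inter_comm]
  | succ n ih =>
    rw [List.ofFn_succ, List.prod_cons, Matrix.mul_apply,
      ← (Fin.consEquiv fun _ => S).sum_comp, Fintype.sum_prod_type]
    simp only [ih, Finset.mul_sum, Fin.consEquiv_apply, Fin.cons_zero, ← Fin.succ_last,
      Fin.cons_succ, Fin.prod_univ_succ, Fin.castSucc_zero, ← Fin.succ_castSucc]
    rw [Finset.sum_comm, Finset.sum_comm (s := (Finset.univ : Finset S))]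
    refine Finset.sum_congr rfl fun κ _ => ?_
    simp [ite_and, Finset.sum_ite_eq]

/-- A down-closed set of columns is an initial segment, so its size is a threshold. The next lemma
is the version for final segments. -/
theorem lt_card_filter_range_iff {a j : ℕ} {P : ℕ → Prop} [DecidablePred P] (hj : j < a)
    (hP : ∀ i k, i ≤ k → k < a → P k → P i) :
    j < ((Finset.range a).filter P).card ↔ P j := by
  constructor
  · intro h
    by_contra hn
    have hsub : (Finset.range a).filter P ⊆ Finset.range j := by
      intro k hk
      rw [Finset.mem_filter, Finset.mem_range] at hk
      by_contra hkj
      exact hn (hP j k (by simpa using hkj) hk.1 hk.2)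
    have := Finset.card_le_card hsub
    rw [Finset.card_range] at this
    omega
  · intro h
    have hsub : Finset.range (j + 1) ⊆ (Finset.range a).filter P := by
      intro k hk
      rw [Finset.mem_range] at hk
      exact Finset.mem_filter.2 ⟨Finset.mem_range.2 (by omega), hP k j (by omega) hj h⟩
    have := Finset.card_le_card hsub
    rw [Finset.card_range] at this
    omega

theorem le_add_card_filter_range_iff {a j : ℕ} {P : ℕ → Prop} [DecidablePred P] (hj : j < a)
    (hP : ∀ i k, i ≤ k → k < a → P i → P k) :
    a ≤ j + ((Finset.range a).filter P).card ↔ P j := by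
  constructor
  · intro h
    by_contra hn
    have hsub : (Finset.range a).filter P ⊆ Finset.Ico (j + 1) a := by
      intro k hk
      rw [Finset.mem_filter, Finset.mem_range] at hk
      refine Finset.mem_Ico.2 ⟨?_, hk.1⟩
      by_contra hkj
      exact hn (hP k j (by omega) hj hk.2)
    have := Finset.card_le_card hsub
    rw [Nat.card_Ico] at this
    omega
  · intro h
    have hsub : Finset.Ico j a ⊆ (Finset.range a).filter P := by
      intro k hk
      rw [Finset.mem_Ico] at hk
      exact Finset.mem_filter.2 ⟨Finset.mem_range.2 hk.2, hP j k hk.1 hk.2 h⟩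
    have := Finset.card_le_card hsub
    rw [Nat.card_Ico] at this
    omega

/-! ### Fillings as chains of sublevel partitions, and their recovery -/

namespace BoxPartition

variable {a b n : ℕ}

/-- The partition of the cells of a column-weakly increasing filling with values less than `m`. -/
def sublevel (a b : ℕ) (A : ℕ → ℕ → ℕ) (hA : ∀ i j, i + 1 < b → j < a → A i j ≤ A (i + 1) j)
    (m : ℕ) : BoxPartition a b :=
  ⟨fun
    | 0 => a
    | i + 1 => if i < b then ((Finset.range a).filter fun j => A i j < m).card else 0, by
    refine ⟨antitone_nat_of_succ_le fun i => ?_, rfl, fun i hi => ?_⟩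
    · rcases i with _ | i
      · simp only
        split_ifs
        · exact (Finset.card_filter_le _ _).trans_eq (Finset.card_range a)
        · exact Nat.zero_le _
      · simp only
        split_ifs with h1 h2 h2
        · refine Finset.card_le_card fun j hj => ?_
          rw [Finset.mem_filter, Finset.mem_range] at hj ⊢
          exact ⟨hj.1, (hA i j h1 hj.1).trans_lt hj.2⟩
        · omega
        · exact Nat.zero_le _
        · exact le_rfl
    · obtain ⟨j, rfl⟩ : ∃ j, i = j + 1 := ⟨i - 1, by omega⟩
      exact if_neg (by omega)⟩

theorem sublevel_succ {A : ℕ → ℕ → ℕ} {hA : ∀ i j, i + 1 < b → j < a → A i j ≤ A (i + 1) j}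
    {m i : ℕ} (hi : i < b) :
    sublevel a b A hA m (i + 1) = ((Finset.range a).filter fun j => A i j < m).card := if_pos hi

theorem ext_of_lt {μ ν : BoxPartition a b} (h : ∀ i, i < b → μ (i + 1) = ν (i + 1)) : μ = ν := by
  refine ext_parts fun i => ?_
  rcases i with _ | i
  · rw [μ.zero_eq, ν.zero_eq]
  · by_cases hi : i < b
    · exact h i hi
    · rw [μ.eq_zero (by omega), ν.eq_zero (by omega)]

theorem sublevel_zero {A : ℕ → ℕ → ℕ} {hA : ∀ i j, i + 1 < b → j < a → A i j ≤ A (i + 1) j} :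
    sublevel a b A hA 0 = empty a b :=
  ext_of_lt fun i hi => by rw [sublevel_succ hi, empty_succ]; simp

theorem sublevel_eq_full {A : ℕ → ℕ → ℕ} {hA : ∀ i j, i + 1 < b → j < a → A i j ≤ A (i + 1) j}
    {m : ℕ} (h : ∀ i j, i < b → j < a → A i j < m) : sublevel a b A hA m = full a b :=
  ext_of_lt fun i hi => by
    rw [sublevel_succ hi, full_of_le (by omega), Finset.filter_true_of_mem, Finset.card_range]
    exact fun j hj => h i j hi (Finset.mem_range.1 hj)

theorem sublevel_mono {A : ℕ → ℕ → ℕ} {hA : ∀ i j, i + 1 < b → j < a → A i j ≤ A (i + 1) j}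
    {m m' : ℕ} (h : m ≤ m') (i : ℕ) : sublevel a b A hA m i ≤ sublevel a b A hA m' i := by
  rcases i with _ | i
  · rw [zero_eq, zero_eq]
  · by_cases hi : i < b
    · rw [sublevel_succ hi, sublevel_succ hi]
      refine Finset.card_le_card fun j hj => ?_
      rw [Finset.mem_filter] at hj ⊢
      exact ⟨hj.1, hj.2.trans_le h⟩
    · rw [eq_zero _ (by omega), eq_zero _ (by omega)]

/-- The step of the chain `κ` in which the row `i` comes to contain more than `j` cells. -/
def stepOf (κ : Fin (n + 1) → BoxPartition a b) (i j : ℕ) : ℕ :=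
  (Finset.univ.filter fun m : Fin n => κ m.succ i ≤ j).card

/-- Along an increasing chain the steps counted by `stepOf` form an initial segment. The count does
not inspect `κ 0`, which needs its own hypothesis. -/
theorem stepOf_lt_iff {κ : Fin (n + 1) → BoxPartition a b} {i j : ℕ}
    (hκ : ∀ (m : Fin n) (i : ℕ), κ m.castSucc i ≤ κ m.succ i) (h0 : κ 0 i ≤ j)
    (m : Fin (n + 1)) : stepOf κ i j < m ↔ j < κ m i := by
  have hmono : Monotone fun m => κ m i := Fin.monotone_iff_le_succ.2 fun m => hκ m i
  rcases Fin.eq_zero_or_eq_succ m with rfl | ⟨r, rfl⟩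
  · simpa using h0
  · constructor
    · intro h
      by_contra hn
      have hsub : Finset.Iic r ⊆ Finset.univ.filter fun m : Fin n => κ m.succ i ≤ j := by
        intro k hk
        rw [Finset.mem_Iic] at hk
        exact Finset.mem_filter.2 ⟨Finset.mem_univ _,
          (hmono (Fin.succ_le_succ_iff.2 hk)).trans (not_lt.1 hn)⟩
      have := Finset.card_le_card hsub
      rw [Fin.card_Iic] at this
      rw [stepOf, Fin.val_succ] at h
      omega
    · intro h
      have hsub : (Finset.univ.filter fun m : Fin n => κ m.succ i ≤ j) ⊆ Finset.Iio r := by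
        intro k hk
        rw [Finset.mem_filter] at hk
        rw [Finset.mem_Iio]
        by_contra hrk
        have : κ r.succ i ≤ κ k.succ i := hmono (Fin.succ_le_succ_iff.2 (not_lt.1 hrk))
        omega
      have := Finset.card_le_card hsub
      rw [Fin.card_Iio] at this
      rw [stepOf, Fin.val_succ]
      omega

theorem stepOf_lt {κ : Fin (n + 1) → BoxPartition a b} {i j : ℕ}
    (hκ : ∀ (m : Fin n) (i : ℕ), κ m.castSucc i ≤ κ m.succ i) (h0 : κ 0 i ≤ j)
    (h1 : κ (Fin.last n) = full a b) (hi : i ≤ b) (hj : j < a) : stepOf κ i j < n := by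
  have := (stepOf_lt_iff hκ h0 (Fin.last n)).2 (by rwa [h1, full_of_le hi])
  simpa using this

theorem stepOf_mono (κ : Fin (n + 1) → BoxPartition a b) {i j j' : ℕ} (h : j ≤ j') :
    stepOf κ i j ≤ stepOf κ i j' :=
  Finset.card_le_card fun _ hm => Finset.mem_filter.2
    ⟨Finset.mem_univ _, (Finset.mem_filter.1 hm).2.trans h⟩

theorem stepOf_mono_row (κ : Fin (n + 1) → BoxPartition a b) {i i' j : ℕ} (h : i ≤ i') :
    stepOf κ i j ≤ stepOf κ i' j :=
  Finset.card_le_card fun _ hm => Finset.mem_filter.2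
    ⟨Finset.mem_univ _, ((κ _).anti h).trans (Finset.mem_filter.1 hm).2⟩

/-- The thresholds end at n, so the bounds are what admits u + 1 and v + 1 as tests. -/
theorem eq_of_forall_lt_iff {u v n : ℕ} (hu : u < n) (hv : v < n)
    (h : ∀ m : Fin (n + 1), u < m ↔ v < m) : u = v := by
  have h1 := (h ⟨u + 1, by omega⟩).1 (Nat.lt_succ_self u)
  have h2 := (h ⟨v + 1, by omega⟩).2 (Nat.lt_succ_self v)
  simp only at h1 h2
  omega

end BoxPartition

/-! ### Schur polynomials of rectangles -/

namespace BoundedSSYT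

open BoxPartition

variable {a b n : ℕ}

theorem mem_rectangle {i j : ℕ} : (i, j) ∈ rectangle a b ↔ i < b ∧ j < a := by
  rw [← YoungDiagram.mem_cells]
  simp [rectangle]

/-- The chain of partitions of a bounded tableau of rectangular shape. -/
def chain (T : BoundedSSYT (rectangle a b) n) (m : Fin (n + 1)) : BoxPartition a b :=
  sublevel a b (fun i j => T.1 i j)
    (fun i _ hi hj => (T.1.col_strict (Nat.lt_succ_self i) (mem_rectangle.2 ⟨hi, hj⟩)).le) m

theorem lt_bound (T : BoundedSSYT (rectangle a b) n) {i j : ℕ} (hi : i < b) (hj : j < a) :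
    T.1 i j < n := T.2 (i, j) (by rw [YoungDiagram.mem_cells, mem_rectangle]; exact ⟨hi, hj⟩)

theorem lt_chain_iff (T : BoundedSSYT (rectangle a b) n) (m : Fin (n + 1)) {i j : ℕ} (hi : i < b)
    (hj : j < a) : j < T.chain m (i + 1) ↔ T.1 i j < m := by
  rw [chain, sublevel_succ hi]
  refine lt_card_filter_range_iff hj fun k l hkl hl h => lt_of_le_of_lt ?_ h
  exact T.1.row_weak_of_le hkl (mem_rectangle.2 ⟨hi, hl⟩)

theorem chain_tailExtends (T : BoundedSSYT (rectangle a b) n) (m : Fin n) :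
    TailExtends 0 (T.chain m.castSucc) (T.chain m.succ) := by
  rw [tailExtends_zero_iff]
  refine fun i => ⟨sublevel_mono (by simp) _, ?_⟩
  rcases i with _ | i
  · rw [zero_eq]
    exact le_width _ _
  · by_cases hi : i + 1 < b
    · rw [chain, chain, sublevel_succ hi, sublevel_succ (by omega)]
      refine Finset.card_le_card fun j hj => ?_
      rw [Finset.mem_filter, Finset.mem_range] at hj ⊢
      have := T.1.col_strict (show i < i + 1 by omega) (mem_rectangle.2 ⟨hi, hj.1⟩)
      refine ⟨hj.1, ?_⟩
      have h2 := hj.2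
      simp only [Fin.val_succ, Fin.val_castSucc] at h2 ⊢
      omega
    · rw [eq_zero _ (show b < i + 1 + 1 by omega)]
      exact Nat.zero_le _

/-- The cells with entry m are those added in step m; in each row their number is a difference of
two sublevel counts. -/
theorem prod_entry (T : BoundedSSYT (rectangle a b) n) (x : Fin n → ℂ) :
    ∏ c : (rectangle a b).cells, x (T.entry c) =
      ∏ m : Fin n, x m ^ numCells (T.chain m.castSucc) (T.chain m.succ) := by
  rw [← Finset.prod_fiberwise (s := Finset.univ) (g := T.entry)]
  refine Finset.prod_congr rfl fun m _ => ?_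
  rw [Finset.prod_congr rfl fun c hc => by rw [(Finset.mem_filter.1 hc).2], Finset.prod_const]
  congr 1
  have h1 : (Finset.univ.filter fun c : (rectangle a b).cells => T.entry c = m).card =
      ((Finset.range b ×ˢ Finset.range a).filter fun p => T.1 p.1 p.2 = m).card := by
    refine Finset.card_bij (fun c _ => c.1) ?_ ?_ ?_
    · intro c hc
      rw [Finset.mem_filter] at hc ⊢
      exact ⟨c.2, by rw [← hc.2]; rfl⟩
    · exact fun c _ d _ h => Subtype.ext h
    · intro p hp
      rw [Finset.mem_filter] at hp
      exact ⟨⟨p, hp.1⟩, Finset.mem_filter.2 ⟨Finset.mem_univ _, Fin.ext hp.2⟩, rfl⟩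
  rw [h1, Finset.card_filter, Finset.sum_product, numCells]
  refine Finset.sum_congr rfl fun i hi => ?_
  rw [Finset.mem_range] at hi
  rw [← Finset.card_filter, chain, chain, sublevel_succ hi, sublevel_succ hi,
    ← Finset.card_sdiff_of_subset]
  · congr 1
    ext j
    simp only [Finset.mem_filter, Finset.mem_sdiff, Fin.val_succ, Fin.val_castSucc]
    constructor
    · rintro ⟨h1, h2⟩
      exact ⟨⟨h1, by omega⟩, fun h => by omega⟩
    · rintro ⟨⟨h1, h2⟩, h3⟩
      have : ¬ T.1 i j < m := fun h => h3 ⟨h1, h⟩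
      exact ⟨h1, by omega⟩
  · intro j hj
    rw [Finset.mem_filter] at hj ⊢
    exact ⟨hj.1, hj.2.trans (by simp)⟩

/-- The tableau of a chain of partitions. -/
def ofChain (κ : Fin (n + 1) → BoxPartition a b) (h0 : κ 0 = empty a b)
    (h1 : κ (Fin.last n) = full a b)
    (hκ : ∀ m : Fin n, TailExtends 0 (κ m.castSucc) (κ m.succ)) :
    BoundedSSYT (rectangle a b) n :=
  have hmono : ∀ (m : Fin n) (i : ℕ), κ m.castSucc i ≤ κ m.succ i := fun m i =>
    ((extends_iff_of_le_one zero_le_one).2 (hκ m)).1 i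
  have hstep : ∀ i j, i + 1 < b → j < a → stepOf κ (i + 1) j < stepOf κ (i + 1 + 1) j := by
    intro i j hi hj
    have hz : ∀ i, κ 0 (i + 1) ≤ j := fun i => by rw [h0, empty_succ]; exact Nat.zero_le _
    have hlt := stepOf_lt hmono (hz (i + 1)) h1 hi hj
    -- The lower cell is present right after its own step; in a horizontal strip the cell above it
    -- was then present before that step.
    have h2 := (stepOf_lt_iff hmono (hz (i + 1))
      (Fin.succ ⟨stepOf κ (i + 1 + 1) j, hlt⟩)).1 (by simp)
    have h3 := (tailExtends_zero_iff.1 (hκ ⟨stepOf κ (i + 1 + 1) j, hlt⟩) (i + 1)).2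
    simpa using (stepOf_lt_iff hmono (hz i)
      (Fin.castSucc ⟨stepOf κ (i + 1 + 1) j, hlt⟩)).2 (h2.trans_le h3)
  ⟨{ entry := fun i j => if i < b ∧ j < a then stepOf κ (i + 1) j else 0
     row_weak' := by
      intro i j j' hj h
      rw [mem_rectangle] at h
      rw [if_pos h, if_pos ⟨h.1, hj.trans h.2⟩]
      exact stepOf_mono κ hj.le
     col_strict' := by
      intro i i' j hi h
      rw [mem_rectangle] at h
      rw [if_pos h, if_pos ⟨hi.trans h.1, h.2⟩]
      induction i', hi using Nat.le_induction with
      | base => exact hstep i j h.1 h.2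
      | succ k hk ih => exact (ih ⟨by omega, h.2⟩).trans (hstep k j h.1 h.2)
     zeros' := by
      intro i j h
      rw [mem_rectangle] at h
      exact if_neg h }, by
    rintro ⟨i, j⟩ hc
    rw [YoungDiagram.mem_cells, mem_rectangle] at hc
    refine (if_pos hc).trans_lt ?_
    exact stepOf_lt hmono (by rw [h0, empty_succ]; exact Nat.zero_le _) h1 hc.1 hc.2⟩

theorem ofChain_apply {κ : Fin (n + 1) → BoxPartition a b} {h0 : κ 0 = empty a b}
    {h1 : κ (Fin.last n) = full a b}
    {hκ : ∀ m : Fin n, TailExtends 0 (κ m.castSucc) (κ m.succ)} {i j : ℕ} (hi : i < b)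
    (hj : j < a) : (ofChain κ h0 h1 hκ).1 i j = stepOf κ (i + 1) j := if_pos ⟨hi, hj⟩

theorem chain_zero (T : BoundedSSYT (rectangle a b) n) : T.chain 0 = empty a b := sublevel_zero

theorem chain_last (T : BoundedSSYT (rectangle a b) n) : T.chain (Fin.last n) = full a b :=
  sublevel_eq_full fun _ _ hi hj => T.lt_bound hi hj

end BoundedSSYT

-- Column strictness of a tableau is exactly the horizontal strip condition on its chain of sublevel
-- shapes.
open BoxPartition in
theorem schur_rectangle {a b n : ℕ} (x : Fin n → ℂ) :
    schur (rectangle a b) x =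
      (List.ofFn fun m => strip a b (x m)).prod (empty a b) (full a b) := by
  classical
  trans ∑ κ ∈ Finset.univ.filter fun κ : Fin (n + 1) → BoxPartition a b =>
      (κ 0 = empty a b ∧ κ (Fin.last n) = full a b) ∧
        ∀ m ∈ Finset.univ, TailExtends 0 (κ (Fin.castSucc m)) (κ m.succ),
    ∏ m, x m ^ numCells (κ m.castSucc) (κ m.succ)
  swap
  · rw [list_ofFn_prod_apply, Finset.sum_filter]
    simp only [strip, tailStrip, Finset.prod_ite_zero, ← ite_and]
    exact Finset.sum_congr rfl fun κ _ => by congr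
  refine Finset.sum_bij' (fun T _ => T.chain)
    (fun κ hκ => BoundedSSYT.ofChain κ (Finset.mem_filter.1 hκ).2.1.1
      (Finset.mem_filter.1 hκ).2.1.2 fun m => (Finset.mem_filter.1 hκ).2.2 m (Finset.mem_univ m))
    ?_ ?_ ?_ ?_ ?_
  · intro T _
    exact Finset.mem_filter.2 ⟨Finset.mem_univ _, ⟨T.chain_zero, T.chain_last⟩,
      fun m _ => T.chain_tailExtends m⟩
  · exact fun _ _ => Finset.mem_univ _
  · intro T _
    refine Subtype.ext (SemistandardYoungTableau.ext fun i j => ?_)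
    by_cases h : i < b ∧ j < a
    · rw [BoundedSSYT.ofChain_apply h.1 h.2]
      have hm : ∀ (m : Fin n) (i : ℕ), T.chain m.castSucc i ≤ T.chain m.succ i := fun m i =>
        sublevel_mono (by simp) _
      have hz : T.chain 0 (i + 1) ≤ j := by rw [T.chain_zero, empty_succ]; exact Nat.zero_le _
      refine eq_of_forall_lt_iff (stepOf_lt hm hz T.chain_last h.1 h.2) (T.lt_bound h.1 h.2)
        fun m => ?_
      rw [stepOf_lt_iff hm hz, T.lt_chain_iff m h.1 h.2]
    · rw [← BoundedSSYT.mem_rectangle] at h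
      rw [SemistandardYoungTableau.zeros _ h, SemistandardYoungTableau.zeros _ h]
  · intro κ hκ
    obtain ⟨-, ⟨h0, h1⟩, h2⟩ := Finset.mem_filter.1 hκ
    have hm : ∀ (m : Fin n) (i : ℕ), κ m.castSucc i ≤ κ m.succ i := fun m i =>
      ((extends_iff_of_le_one zero_le_one).2 (h2 m (Finset.mem_univ m))).1 i
    refine funext fun m => ext_of_lt fun i hi => ?_
    rw [BoundedSSYT.chain, sublevel_succ hi]
    have : (Finset.range a).filter (fun j => (BoundedSSYT.ofChain κ h0 h1 fun m =>
        h2 m (Finset.mem_univ m)).1 i j < m) = Finset.range (κ m (i + 1)) := by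
      ext j
      rw [Finset.mem_filter, Finset.mem_range, Finset.mem_range]
      constructor
      · rintro ⟨hj, h⟩
        rw [BoundedSSYT.ofChain_apply hi hj] at h
        exact (stepOf_lt_iff hm (by rw [h0, empty_succ]; exact Nat.zero_le _) m).1 h
      · intro h
        have hj : j < a := h.trans_le (le_width _ _)
        rw [BoundedSSYT.ofChain_apply hi hj]
        exact ⟨hj, (stepOf_lt_iff hm (by rw [h0, empty_succ]; exact Nat.zero_le _) m).2 h⟩
    rw [this, Finset.card_range]
  · exact fun T _ => T.prod_entry x

/-! ### The generating function of plane partitions -/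

namespace BoxedPlanePartition

open BoxPartition

variable {a b c : ℕ}

theorem ext_entry {π π' : BoxedPlanePartition a b c}
    (h : ∀ i j, i < b → j < a → π.entry i j = π'.entry i j) : π = π' := by
  have : π.entry = π'.entry := by
    funext i j
    by_cases hi : i < b
    · by_cases hj : j < a
      · exact h i j hi hj
      · rw [π.cols_le i j (by omega), π'.cols_le i j (by omega)]
    · rw [π.rows_le i j (by omega), π'.rows_le i j (by omega)]
  cases π
  cases π'
  simpa using this

theorem entry_anti (π : BoxedPlanePartition a b c) {i i' j j' : ℕ} (hi : i ≤ i') (hj : j ≤ j') :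
    π.entry i' j' ≤ π.entry i j :=
  (antitone_nat_of_succ_le (f := fun i => π.entry i j') (fun k => π.col_anti k j') hi).trans
    (antitone_nat_of_succ_le (f := fun j => π.entry i j) (fun k => π.row_anti i k) hj)

theorem entry_le_height (π : BoxedPlanePartition a b c) (i j : ℕ) : π.entry i j ≤ c :=
  (π.entry_anti (Nat.zero_le i) (Nat.zero_le j)).trans π.entry_le

instance : Finite (BoxedPlanePartition a b c) :=
  Finite.of_injective (fun (π : BoxedPlanePartition a b c) (i : Fin b) (j : Fin a) =>
    (⟨π.entry i j, Nat.lt_succ_of_le (π.entry_le_height i j)⟩ : Fin (c + 1)))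
    fun π π' h => ext_entry fun i j hi hj => by
      simpa using congrFun (congrFun h ⟨i, hi⟩) ⟨j, hj⟩

noncomputable instance : Fintype (BoxedPlanePartition a b c) := Fintype.ofFinite _

/-- The number of lowermost entries equal to `k` in the columns of a plane partition. -/
def corners (π : BoxedPlanePartition a b c) (k : ℕ) : ℕ :=
  ((Finset.range b ×ˢ Finset.range a).filter fun p =>
    π.entry p.1 p.2 = k ∧ π.entry (p.1 + 1) p.2 < k).card

/-- The chain of partitions of a plane partition, which is rotated by 180 degrees. -/
def chain (π : BoxedPlanePartition a b c) (m : Fin (c + 1 + 1)) : BoxPartition a b :=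
  sublevel a b (fun i j => π.entry (b - 1 - i) j)
    (fun i _ _ _ => π.entry_anti (by omega) le_rfl) m

theorem chain_zero (π : BoxedPlanePartition a b c) : π.chain 0 = empty a b := sublevel_zero

theorem chain_last (π : BoxedPlanePartition a b c) : π.chain (Fin.last (c + 1)) = full a b :=
  sublevel_eq_full fun _ _ _ _ => Nat.lt_succ_of_le (π.entry_le_height _ _)

theorem chain_mono (π : BoxedPlanePartition a b c) (m : Fin (c + 1)) (i : ℕ) :
    π.chain m.castSucc i ≤ π.chain m.succ i := sublevel_mono (by simp) _

theorem chain_apply (π : BoxedPlanePartition a b c) (m : Fin (c + 1 + 1)) {i : ℕ} (hi : i < b) :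
    π.chain m (b - i) = ((Finset.range a).filter fun j => π.entry i j < m).card := by
  obtain ⟨k, hk⟩ : ∃ k, b = i + 1 + k := ⟨b - (i + 1), by omega⟩
  rw [show b - i = k + 1 by omega, chain, sublevel_succ (by omega),
    show b - 1 - k = i by omega]

theorem le_add_chain_iff (π : BoxedPlanePartition a b c) (m : Fin (c + 1 + 1)) {i j : ℕ}
    (hi : i < b) (hj : j < a) : a ≤ j + π.chain m (b - i) ↔ π.entry i j < m := by
  rw [chain_apply π m hi]
  exact le_add_card_filter_range_iff hj fun k l hkl _ h =>
    (π.entry_anti le_rfl hkl).trans_lt h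

/-- The rotation places row k + 1 of π above row k, so the lowermost entry ℓ + 1 of a column becomes
the uppermost new cell. -/
theorem corners_eq_topCells (π : BoxedPlanePartition a b c) (ℓ : Fin c) :
    π.corners (ℓ + 1) = topCells (π.chain ℓ.succ.castSucc) (π.chain ℓ.succ.succ) := by
  rw [corners, Finset.card_filter, Finset.sum_product, topCells, ← Finset.sum_range_reflect]
  refine Finset.sum_congr rfl fun i hi => ?_
  rw [Finset.mem_range] at hi
  obtain ⟨k, rfl⟩ : ∃ k, b = i + 1 + k := ⟨b - (i + 1), by omega⟩
  rw [← Finset.card_filter, show i + 1 + k - 1 - i = k by omega]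
  have e1 := π.chain_apply ℓ.succ.castSucc (show k < i + 1 + k by omega)
  have e2 := π.chain_apply ℓ.succ.succ (show k < i + 1 + k by omega)
  rw [show i + 1 + k - k = i + 1 by omega] at e1 e2
  have e3 : π.chain ℓ.succ.castSucc i =
      ((Finset.range a).filter fun j => π.entry (k + 1) j < ℓ + 1).card := by
    rcases i with _ | i
    -- Row b of π is zero, in agreement with a zeroth part `a`; this uses that the height ℓ + 1 is
    -- positive.
    · rw [zero_eq, Finset.filter_true_of_mem, Finset.card_range]
      intro j _
      rw [π.rows_le _ _ (by omega)]
      omega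
    · have := π.chain_apply ℓ.succ.castSucc (show k + 1 < i + 1 + 1 + k by omega)
      rw [show i + 1 + 1 + k - (k + 1) = i + 1 by omega] at this
      simpa using this
  rw [e1, e2, e3]
  set P := (Finset.range a).filter fun j => π.entry k j < (ℓ.succ.succ : Fin (c + 1 + 1))
  set Q := (Finset.range a).filter fun j => π.entry (k + 1) j < ℓ + 1
  set R := (Finset.range a).filter fun j => π.entry k j < (ℓ.succ.castSucc : Fin (c + 1 + 1))
  -- Both are final segments of `range a`, as the rows of π decrease.
  have hPQ : P ⊆ Q ∨ Q ⊆ P := by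
    by_contra! h
    obtain ⟨i, hiP, hiQ⟩ := Finset.not_subset.1 h.1
    obtain ⟨j, hjQ, hjP⟩ := Finset.not_subset.1 h.2
    simp only [P, Q, Finset.mem_filter, not_and, not_lt] at hiP hiQ hjP hjQ
    rcases le_total i j with hij | hij
    · have h1 := hjP hjQ.1
      have h2 := π.entry_anti (le_refl k) hij
      omega
    · have h1 := hiQ hiP.1
      have h2 := π.entry_anti (le_refl (k + 1)) hij
      omega
  have hmin : min P.card Q.card = (P ∩ Q).card := by
    rcases hPQ with h | h
    · rw [Finset.inter_eq_left.2 h, min_eq_left (Finset.card_le_card h)]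
    · rw [Finset.inter_eq_right.2 h, min_eq_right (Finset.card_le_card h)]
  have hR : R ⊆ P ∩ Q := by
    intro j hj
    simp only [P, Q, R, Finset.mem_inter, Finset.mem_filter, Fin.val_succ,
      Fin.val_castSucc] at hj ⊢
    have := π.col_anti k j
    exact ⟨⟨hj.1, by omega⟩, hj.1, by omega⟩
  rw [hmin, ← Finset.card_sdiff_of_subset hR]
  congr 1
  ext j
  simp only [P, Q, R, Finset.mem_inter, Finset.mem_filter, Finset.mem_sdiff, Fin.val_succ,
    Fin.val_castSucc, not_and, not_lt]
  constructor
  · rintro ⟨h1, h2, h3⟩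
    exact ⟨⟨⟨h1, by omega⟩, h1, h3⟩, fun _ => by omega⟩
  · rintro ⟨⟨⟨h1, h2⟩, -, h3⟩, h4⟩
    have := h4 h1
    exact ⟨h1, by omega, h3⟩

/-- The plane partition of a chain of partitions. -/
def ofChain (κ : Fin (c + 1 + 1) → BoxPartition a b) (h0 : κ 0 = empty a b)
    (h1 : κ (Fin.last (c + 1)) = full a b)
    (hκ : ∀ (m : Fin (c + 1)) (i : ℕ), κ m.castSucc i ≤ κ m.succ i) :
    BoxedPlanePartition a b c where
  -- The rotation is undone; the rows of `κ` are numbered from 1, the other indices from 0.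
  entry i j := if i < b ∧ j < a then stepOf κ (b - i) (a - 1 - j) else 0
  row_anti i j := by
    split_ifs
    · exact stepOf_mono κ (by omega)
    · omega
    · exact Nat.zero_le _
    · exact le_rfl
  col_anti i j := by
    split_ifs
    · exact stepOf_mono_row κ (by omega)
    · omega
    · exact Nat.zero_le _
    · exact le_rfl
  entry_le := by
    split_ifs with h
    · obtain ⟨k, rfl⟩ : ∃ k, b = k + 1 := ⟨b - 1, by omega⟩
      exact Nat.le_of_lt_succ (stepOf_lt hκ (by rw [h0, Nat.sub_zero, empty_succ]; omega) h1
        (by omega) (by omega))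
    · exact Nat.zero_le _
  rows_le i j hi := if_neg (by omega)
  cols_le i j hj := if_neg (by omega)

theorem ofChain_apply {κ : Fin (c + 1 + 1) → BoxPartition a b} {h0 : κ 0 = empty a b}
    {h1 : κ (Fin.last (c + 1)) = full a b}
    {hκ : ∀ (m : Fin (c + 1)) (i : ℕ), κ m.castSucc i ≤ κ m.succ i} {i j : ℕ} (hi : i < b)
    (hj : j < a) : (ofChain κ h0 h1 hκ).entry i j = stepOf κ (b - i) (a - 1 - j) :=
  if_pos ⟨hi, hj⟩

theorem extends_height_iff {ν lam : BoxPartition a b} : Extends b ν lam ↔ ∀ i, ν i ≤ lam i :=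
  ⟨fun h => h.1, fun h => ⟨h, fun i hi => by rw [lam.eq_zero (by omega)]; exact Nat.zero_le _⟩⟩

theorem empty_apply_le {i j : ℕ} (hi : 0 < i) : empty a b i ≤ j := by
  obtain ⟨k, rfl⟩ : ∃ k, i = k + 1 := ⟨i - 1, by omega⟩
  rw [empty_succ]
  exact Nat.zero_le j

/-- There is one growth step for each entry 0, …, c. Entries 0 form no corners, hence the weight 1
in front. -/
theorem sum_prod_corners (x : Fin c → ℂ) :
    ∑ π : BoxedPlanePartition a b c, ∏ ℓ, x ℓ ^ π.corners (ℓ + 1) =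
      (List.ofFn fun m => growth a b b ((Fin.cons 1 x : Fin (c + 1) → ℂ) m) 1).prod
        (empty a b) (full a b) := by
  classical
  trans ∑ κ ∈ Finset.univ.filter fun κ : Fin (c + 1 + 1) → BoxPartition a b =>
      (κ 0 = empty a b ∧ κ (Fin.last (c + 1)) = full a b) ∧
        ∀ m ∈ Finset.univ, Extends b (κ (Fin.castSucc m)) (κ m.succ),
    ∏ m, (Fin.cons 1 x : Fin (c + 1) → ℂ) m ^ topCells (κ m.castSucc) (κ m.succ)
  swap
  · rw [list_ofFn_prod_apply, Finset.sum_filter]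
    simp only [growth, one_pow, mul_one, Finset.prod_ite_zero, ← ite_and]
    exact Finset.sum_congr rfl fun κ _ => by congr
  have hm : ∀ κ ∈ Finset.univ.filter fun κ : Fin (c + 1 + 1) → BoxPartition a b =>
      (κ 0 = empty a b ∧ κ (Fin.last (c + 1)) = full a b) ∧
        ∀ m ∈ Finset.univ, Extends b (κ (Fin.castSucc m)) (κ m.succ),
      ∀ (m : Fin (c + 1)) (i : ℕ), κ m.castSucc i ≤ κ m.succ i := fun κ hκ m =>
    ((Finset.mem_filter.1 hκ).2.2 m (Finset.mem_univ m)).1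
  refine Finset.sum_bij' (fun π _ => π.chain)
    (fun κ hκ => ofChain κ (Finset.mem_filter.1 hκ).2.1.1 (Finset.mem_filter.1 hκ).2.1.2
      (hm κ hκ)) ?_ ?_ ?_ ?_ ?_
  · intro π _
    exact Finset.mem_filter.2 ⟨Finset.mem_univ _, ⟨π.chain_zero, π.chain_last⟩,
      fun m _ => extends_height_iff.2 (π.chain_mono m)⟩
  · exact fun _ _ => Finset.mem_univ _
  · intro π _
    refine ext_entry fun i j hi hj => ?_
    rw [ofChain_apply hi hj]
    have hz : π.chain 0 (b - i) ≤ a - 1 - j := by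
      rw [π.chain_zero]
      exact empty_apply_le (by omega)
    refine eq_of_forall_lt_iff (stepOf_lt π.chain_mono hz π.chain_last (by omega) (by omega))
      (Nat.lt_succ_of_le (π.entry_le_height i j)) fun m => ?_
    rw [stepOf_lt_iff π.chain_mono hz, ← π.le_add_chain_iff m hi hj]
    omega
  · intro κ hκ
    obtain ⟨-, ⟨h0, h1⟩, -⟩ := Finset.mem_filter.1 hκ
    refine funext fun m => ext_of_lt fun i hi => ?_
    have e1 := chain_apply (ofChain κ h0 h1 (hm κ hκ)) m (show b - 1 - i < b by omega)
    rw [show b - (b - 1 - i) = i + 1 by omega] at e1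
    rw [e1]
    have hw := (κ m).le_width (i + 1)
    have : (Finset.range a).filter (fun j => (ofChain κ h0 h1 (hm κ hκ)).entry (b - 1 - i) j < m) =
        Finset.Ico (a - κ m (i + 1)) a := by
      ext j
      rw [Finset.mem_filter, Finset.mem_range, Finset.mem_Ico]
      refine ⟨fun ⟨hj, h⟩ => ⟨?_, hj⟩, fun ⟨h, hj⟩ => ⟨hj, ?_⟩⟩
      · rw [ofChain_apply (by omega) hj, stepOf_lt_iff (hm κ hκ)
          (by rw [h0]; exact empty_apply_le (by omega)),
          show b - (b - 1 - i) = i + 1 by omega] at h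
        omega
      · rw [ofChain_apply (by omega) hj, stepOf_lt_iff (hm κ hκ)
          (by rw [h0]; exact empty_apply_le (by omega)),
          show b - (b - 1 - i) = i + 1 by omega]
        omega
    rw [this, Nat.card_Ico]
    omega
  · intro π _
    rw [Fin.prod_univ_succ]
    simp only [Fin.cons_zero, one_pow, one_mul, Fin.cons_succ]
    exact Finset.prod_congr rfl fun ℓ _ => by rw [π.corners_eq_topCells]

/-- The generating function of the corners of boxed plane partitions is a Schur polynomial. -/
theorem sum_prod_corners_eq_strip (hb : 0 < b) (x : Fin c → ℂ) :
    ∑ π : BoxedPlanePartition a b c, ∏ ℓ, x ℓ ^ π.corners (ℓ + 1) =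
      ((List.ofFn fun ℓ => strip a b (x ℓ)).prod * strip a b 1 ^ b : Matrix _ _ ℂ)
        (empty a b) (full a b) := by
  have h := prod_growth_eq_prod_strip (a := a) hb 1 (List.ofFn (Fin.cons 1 x : Fin (c + 1) → ℂ))
  rw [List.map_ofFn, List.map_ofFn] at h
  rw [sum_prod_corners]
  refine h.trans ?_
  simp only [List.ofFn_succ, Function.comp_def, List.prod_cons, Fin.cons_zero, Fin.cons_succ]
  -- The strip of weight 1 from the entries 0 moves to the other b - 1 strips of weight 1.
  have hcomm : Commute (strip a b (1 : ℂ)) (List.ofFn fun ℓ => strip a b (x ℓ)).prod := by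
    refine Commute.list_prod_right _ _ fun M hM => ?_
    obtain ⟨ℓ, rfl⟩ := List.mem_ofFn.1 hM
    exact strip_commute _ _
  rw [hcomm.eq, mul_assoc, mul_pow_sub_one hb.ne']

end BoxedPlanePartition

-- Together with the next lemma, this is all the symmetry of Schur polynomials that is needed: the b
-- ones may precede or follow the variables because strips commute.
open BoxPartition in
theorem schur_ones_append {a b c : ℕ} (x : Fin c → ℂ) :
    schur (rectangle a b) (Fin.append (fun _ : Fin b => 1) x) =
      ((List.ofFn fun ℓ => strip a b (x ℓ)).prod * strip a b 1 ^ b : Matrix _ _ ℂ)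
        (empty a b) (full a b) := by
  rw [schur_rectangle]
  have e : (List.ofFn fun m : Fin (b + c) =>
      strip a b ((Fin.append (fun _ : Fin b => (1 : ℂ)) x) m)) =
      (List.ofFn fun _ : Fin b => strip a b (1 : ℂ)) ++ List.ofFn fun ℓ => strip a b (x ℓ) := by
    rw [← List.ofFn_fin_append]
    congr 1
    funext m
    refine Fin.addCases (fun i => ?_) (fun i => ?_) m <;> simp
  rw [e, List.prod_append, List.ofFn_const, List.prod_replicate]
  have hcomm : Commute (strip a b (1 : ℂ) ^ b) (List.ofFn fun ℓ => strip a b (x ℓ)).prod := by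
    refine Commute.pow_left (Commute.list_prod_right _ _ fun M hM => ?_) b
    obtain ⟨ℓ, rfl⟩ := List.mem_ofFn.1 hM
    exact strip_commute _ _
  rw [hcomm.eq]

open BoxPartition in
theorem schur_append_ones {a b c : ℕ} (x : Fin c → ℂ) :
    schur (rectangle a b) (fun i : Fin (b + c) => if h : (i : ℕ) < c then x ⟨i, h⟩ else 1) =
      ((List.ofFn fun ℓ => strip a b (x ℓ)).prod * strip a b 1 ^ b : Matrix _ _ ℂ)
        (empty a b) (full a b) := by
  rw [schur_rectangle]
  have e : (List.ofFn fun m : Fin (b + c) =>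
      strip a b (if h : (m : ℕ) < c then x ⟨m, h⟩ else 1)) =
      (List.ofFn fun ℓ => strip a b (x ℓ)) ++ List.ofFn fun _ : Fin b => strip a b (1 : ℂ) := by
    refine List.ext_getElem (by simp [add_comm]) fun i h1 h2 => ?_
    rw [List.getElem_append]
    by_cases h : i < c <;> simp [h]
  rw [e, List.prod_append, List.ofFn_const, List.prod_replicate]

/-! ### Lozenge tilings and height functions -/

section Tilings

variable {a b c : ℕ}

/-- A family of lozenges tiles the hexagon. -/
def IsTiling (a b c : ℕ) (V : Lozenge → Prop) : Prop :=
  (∀ L, V L → L.triangles ⊆ hexagon a b c) ∧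
    ∀ t ∈ hexagon a b c, ∃! L, V L ∧ t ∈ L.triangles

theorem mem_hexagonPoints {u v : ℤ} : (u, v) ∈ hexagonPoints a b c ↔
    -(c : ℤ) ≤ u ∧ u ≤ b ∧ -(c : ℤ) ≤ v ∧ v ≤ a ∧ -(a : ℤ) ≤ u - v ∧ u - v ≤ b := Iff.rfl

theorem pointsLeft_mem_hexagon {u v : ℤ} : ⟨.pointsLeft, (u, v)⟩ ∈ hexagon a b c ↔
    (u, v) ∈ hexagonPoints a b c ∧ (u + 1, v) ∈ hexagonPoints a b c ∧
      (u + 1, v + 1) ∈ hexagonPoints a b c := by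
  simp [hexagon, Triangle.vertices, Set.insert_subset_iff]

theorem pointsRight_mem_hexagon {u v : ℤ} : ⟨.pointsRight, (u, v)⟩ ∈ hexagon a b c ↔
    (u, v) ∈ hexagonPoints a b c ∧ (u, v + 1) ∈ hexagonPoints a b c ∧
      (u + 1, v + 1) ∈ hexagonPoints a b c := by
  simp [hexagon, Triangle.vertices, Set.insert_subset_iff]

theorem top_subset_hexagon {u v : ℤ} :
    (⟨.top, (u, v)⟩ : Lozenge).triangles ⊆ hexagon a b c ↔
      (u - 1, v - 1) ∈ hexagonPoints a b c ∧ (u, v - 1) ∈ hexagonPoints a b c ∧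
        (u - 1, v) ∈ hexagonPoints a b c ∧ (u, v) ∈ hexagonPoints a b c := by
  simp only [Lozenge.triangles, Set.insert_subset_iff, Set.singleton_subset_iff, Prod.mk_sub_mk,
    pointsLeft_mem_hexagon, pointsRight_mem_hexagon, sub_add_cancel]
  tauto

theorem left_subset_hexagon {u v : ℤ} :
    (⟨.left, (u, v)⟩ : Lozenge).triangles ⊆ hexagon a b c ↔
      (u, v) ∈ hexagonPoints a b c ∧ (u + 1, v) ∈ hexagonPoints a b c ∧
        (u + 1, v + 1) ∈ hexagonPoints a b c ∧ (u, v - 1) ∈ hexagonPoints a b c := by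
  simp only [Lozenge.triangles, Set.insert_subset_iff, Set.singleton_subset_iff, Prod.mk_sub_mk,
    pointsLeft_mem_hexagon, pointsRight_mem_hexagon, sub_add_cancel, sub_zero]
  tauto

theorem right_subset_hexagon {u v : ℤ} :
    (⟨.right, (u, v)⟩ : Lozenge).triangles ⊆ hexagon a b c ↔
      (u, v) ∈ hexagonPoints a b c ∧ (u, v + 1) ∈ hexagonPoints a b c ∧
        (u + 1, v + 1) ∈ hexagonPoints a b c ∧ (u - 1, v) ∈ hexagonPoints a b c := by
  simp only [Lozenge.triangles, Set.insert_subset_iff, Set.singleton_subset_iff, Prod.mk_sub_mk,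
    pointsLeft_mem_hexagon, pointsRight_mem_hexagon, sub_add_cancel, sub_zero]
  tauto

theorem pointsLeft_mem_triangles {u v : ℤ} {L : Lozenge} :
    ⟨.pointsLeft, (u, v)⟩ ∈ L.triangles ↔
      L = ⟨.top, (u + 1, v + 1)⟩ ∨ L = ⟨.left, (u, v)⟩ ∨ L = ⟨.right, (u + 1, v)⟩ := by
  obtain ⟨k, r, s⟩ := L
  cases k <;> simp [Lozenge.triangles] <;> omega

theorem pointsRight_mem_triangles {u v : ℤ} {L : Lozenge} :
    ⟨.pointsRight, (u, v)⟩ ∈ L.triangles ↔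
      L = ⟨.top, (u + 1, v + 1)⟩ ∨ L = ⟨.left, (u, v + 1)⟩ ∨ L = ⟨.right, (u, v)⟩ := by
  obtain ⟨k, r, s⟩ := L
  cases k <;> simp [Lozenge.triangles] <;> omega

open Classical in
/-- The indicator function of a family of lozenges. -/
noncomputable def indicator (V : Lozenge → Prop) (L : Lozenge) : ℤ := if V L then 1 else 0

theorem indicator_of_pos {V : Lozenge → Prop} {L : Lozenge} (h : V L) : indicator V L = 1 :=
  if_pos h

theorem indicator_of_neg {V : Lozenge → Prop} {L : Lozenge} (h : ¬ V L) : indicator V L = 0 :=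
  if_neg h

theorem indicator_eq_one_iff {V : Lozenge → Prop} {L : Lozenge} : indicator V L = 1 ↔ V L := by
  by_cases h : V L <;> simp [indicator, h]

theorem indicator_nonneg (V : Lozenge → Prop) (L : Lozenge) : 0 ≤ indicator V L := by
  by_cases h : V L <;> simp [indicator, h]

theorem indicator_le_one (V : Lozenge → Prop) (L : Lozenge) : indicator V L ≤ 1 := by
  by_cases h : V L <;> simp [indicator, h]

/-- Exact covering of a triangle becomes a linear equation, to be combined with height increments.
-/
theorem existsUnique_iff_indicator {V : Lozenge → Prop} {L₁ L₂ L₃ : Lozenge} {P : Lozenge → Prop}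
    (hP : ∀ L, P L ↔ L = L₁ ∨ L = L₂ ∨ L = L₃) (h12 : L₁ ≠ L₂) (h13 : L₁ ≠ L₃) (h23 : L₂ ≠ L₃) :
    (∃! L, V L ∧ P L) ↔ indicator V L₁ + indicator V L₂ + indicator V L₃ = 1 := by
  simp only [hP]
  constructor
  · rintro ⟨L, ⟨hL, rfl | rfl | rfl⟩, hu⟩
    · rw [indicator_of_pos hL, indicator_of_neg fun h => h12 (hu L₂ ⟨h, by simp⟩).symm,
        indicator_of_neg fun h => h13 (hu L₃ ⟨h, by simp⟩).symm]
      norm_num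
    · rw [indicator_of_pos hL, indicator_of_neg fun h => h12 (hu L₁ ⟨h, by simp⟩),
        indicator_of_neg fun h => h23 (hu L₃ ⟨h, by simp⟩).symm]
      norm_num
    · rw [indicator_of_pos hL, indicator_of_neg fun h => h13 (hu L₁ ⟨h, by simp⟩),
        indicator_of_neg fun h => h23 (hu L₂ ⟨h, by simp⟩)]
      norm_num
  · intro h
    by_cases h1 : V L₁ <;> by_cases h2 : V L₂ <;> by_cases h3 : V L₃ <;>
      simp only [indicator, h1, h2, h3, if_true, if_false] at h <;> norm_num at h
    · exact ⟨L₁, ⟨h1, by simp⟩, by rintro L ⟨hL, rfl | rfl | rfl⟩ <;> tauto⟩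
    · exact ⟨L₂, ⟨h2, by simp⟩, by rintro L ⟨hL, rfl | rfl | rfl⟩ <;> tauto⟩
    · exact ⟨L₃, ⟨h3, by simp⟩, by rintro L ⟨hL, rfl | rfl | rfl⟩ <;> tauto⟩

theorem existsUnique_pointsLeft {V : Lozenge → Prop} {u v : ℤ} :
    (∃! L, V L ∧ (⟨.pointsLeft, (u, v)⟩ : Triangle) ∈ L.triangles) ↔
      indicator V ⟨.top, (u + 1, v + 1)⟩ + indicator V ⟨.left, (u, v)⟩ +
        indicator V ⟨.right, (u + 1, v)⟩ = 1 :=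
  existsUnique_iff_indicator (fun _ => pointsLeft_mem_triangles) (by simp) (by simp) (by simp)

theorem existsUnique_pointsRight {V : Lozenge → Prop} {u v : ℤ} :
    (∃! L, V L ∧ (⟨.pointsRight, (u, v)⟩ : Triangle) ∈ L.triangles) ↔
      indicator V ⟨.top, (u + 1, v + 1)⟩ + indicator V ⟨.left, (u, v + 1)⟩ +
        indicator V ⟨.right, (u, v)⟩ = 1 :=
  existsUnique_iff_indicator (fun _ => pointsRight_mem_triangles) (by simp) (by simp) (by simp)

/-- `h` gives the `z`-coordinates of the lattice points in a picture of a pile of cubes with the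
lozenges `V`. -/
structure IsHeightFunction (a b c : ℕ) (V : Lozenge → Prop) (h : ℤ → ℤ → ℤ) : Prop where
  subset : ∀ L, V L → L.triangles ⊆ hexagon a b c
  bottom : ∀ u v, (u, v) ∈ hexagonPoints a b c → u = b ∨ v = a → h u v = 0
  -- A unit step along an axis changes z as in space, unless the segment is the short diagonal of a
  -- lozenge, where it is off by one.
  top_rule : ∀ u v, (u, v) ∈ hexagonPoints a b c → (u + 1, v + 1) ∈ hexagonPoints a b c →
    h u v - h (u + 1) (v + 1) = 1 - indicator V ⟨.top, (u + 1, v + 1)⟩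
  left_rule : ∀ u v, (u, v) ∈ hexagonPoints a b c → (u + 1, v) ∈ hexagonPoints a b c →
    h u v - h (u + 1) v = indicator V ⟨.left, (u, v)⟩
  right_rule : ∀ u v, (u, v) ∈ hexagonPoints a b c → (u, v + 1) ∈ hexagonPoints a b c →
    h u v - h u (v + 1) = indicator V ⟨.right, (u, v)⟩

/-- In each triangle the vertical increment is the sum of the other two; inserting the rules leaves
the equation for a unique covering lozenge. -/
theorem IsHeightFunction.isTiling {V : Lozenge → Prop} {h : ℤ → ℤ → ℤ}
    (hh : IsHeightFunction a b c V h) : IsTiling a b c V := by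
  refine ⟨hh.subset, ?_⟩
  rintro ⟨k, u, v⟩ ht
  cases k
  · rw [existsUnique_pointsLeft]
    obtain ⟨h1, h2, h3⟩ := pointsLeft_mem_hexagon.1 ht
    have := hh.top_rule u v h1 h3
    have := hh.left_rule u v h1 h2
    have := hh.right_rule (u + 1) v h2 h3
    omega
  · rw [existsUnique_pointsRight]
    obtain ⟨h1, h2, h3⟩ := pointsRight_mem_hexagon.1 ht
    have := hh.top_rule u v h1 h3
    have := hh.right_rule u v h1 h2
    have := hh.left_rule u (v + 1) h2 h3
    omega

/-- Induction up the vertical lines of the hexagon. -/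
theorem hexagonPoints_induction_up {P : ℤ → ℤ → Prop}
    (base : ∀ u v, (u, v) ∈ hexagonPoints a b c → u = b ∨ v = a → P u v)
    (step : ∀ u v, (u, v) ∈ hexagonPoints a b c → (u + 1, v + 1) ∈ hexagonPoints a b c →
      P (u + 1) (v + 1) → P u v) (u v : ℤ) (h : (u, v) ∈ hexagonPoints a b c) : P u v := by
  obtain ⟨n, hn⟩ : ∃ n : ℕ, (b : ℤ) - u ≤ n := ⟨((b : ℤ) - u).toNat, Int.self_le_toNat _⟩
  induction n generalizing u v with
  | zero =>
    refine base u v h (Or.inl ?_)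
    rw [mem_hexagonPoints] at h
    omega
  | succ n ih =>
    by_cases hb : u = b ∨ v = a
    · exact base u v h hb
    · have h' : (u + 1, v + 1) ∈ hexagonPoints a b c := by
        rw [mem_hexagonPoints] at h ⊢
        omega
      exact step u v h h' (ih _ _ h' (by push_cast at hn; omega))

/-- Induction down the vertical lines of the hexagon. -/
theorem hexagonPoints_induction_down {P : ℤ → ℤ → Prop}
    (base : ∀ u v, (u, v) ∈ hexagonPoints a b c → u = -c ∨ v = -c → P u v)
    (step : ∀ u v, (u, v) ∈ hexagonPoints a b c → (u + 1, v + 1) ∈ hexagonPoints a b c →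
      P u v → P (u + 1) (v + 1)) (u v : ℤ) (h : (u, v) ∈ hexagonPoints a b c) : P u v := by
  obtain ⟨n, hn⟩ : ∃ n : ℕ, (c : ℤ) + u ≤ n := ⟨((c : ℤ) + u).toNat, Int.self_le_toNat _⟩
  induction n generalizing u v with
  | zero =>
    refine base u v h (Or.inl ?_)
    rw [mem_hexagonPoints] at h
    omega
  | succ n ih =>
    by_cases hb : u = -c ∨ v = -c
    · exact base u v h hb
    · have h' : (u - 1, v - 1) ∈ hexagonPoints a b c := by
        rw [mem_hexagonPoints] at h ⊢
        omega
      have := step (u - 1) (v - 1) h' (by simpa using h)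
        (ih _ _ h' (by push_cast at hn; omega))
      simpa using this

/-- The number of vertical unit segments below a lattice point that are not diagonals of top
lozenges. -/
noncomputable def tilingHeight (a b : ℕ) (V : Lozenge → Prop) (u v : ℤ) : ℤ :=
  ∑ m ∈ Finset.range (min ((b : ℤ) - u) (a - v)).toNat,
    (1 - indicator V ⟨.top, (u + 1 + m, v + 1 + m)⟩)

theorem tilingHeight_top_rule {V : Lozenge → Prop} {u v : ℤ} (hu : u + 1 ≤ b) (hv : v + 1 ≤ a) :
    tilingHeight a b V u v - tilingHeight a b V (u + 1) (v + 1) =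
      1 - indicator V ⟨.top, (u + 1, v + 1)⟩ := by
  have e : (min ((b : ℤ) - u) (a - v)).toNat =
      (min ((b : ℤ) - (u + 1)) (a - (v + 1))).toNat + 1 := by omega
  rw [tilingHeight, e, Finset.sum_range_succ', tilingHeight]
  simp only [Nat.cast_zero, add_zero, Nat.cast_add, Nat.cast_one]
  rw [add_sub_right_comm, ← Finset.sum_sub_distrib, Finset.sum_eq_zero, zero_add]
  intro m _
  rw [show u + 1 + ((m : ℤ) + 1) = u + 1 + 1 + m by ring,
    show v + 1 + ((m : ℤ) + 1) = v + 1 + 1 + m by ring, sub_self]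

theorem tilingHeight_bottom {V : Lozenge → Prop} {u v : ℤ} (h : u = b ∨ v = a) :
    tilingHeight a b V u v = 0 := by
  rw [tilingHeight, show (min ((b : ℤ) - u) (a - v)).toNat = 0 by omega, Finset.sum_range_zero]

/-- By induction on the distance from the lower sides: the equation of a triangle yields one slanted
increment from the vertical one and from the other slanted side, which is nearer to the lower sides.
-/
theorem IsTiling.side_rules {V : Lozenge → Prop} (hV : IsTiling a b c V) (n : ℕ) (u v : ℤ)
    (hn : (b : ℤ) - u + (a - v) ≤ n) (h : (u, v) ∈ hexagonPoints a b c) :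
    ((u + 1, v) ∈ hexagonPoints a b c →
      tilingHeight a b V u v - tilingHeight a b V (u + 1) v = indicator V ⟨.left, (u, v)⟩) ∧
    ((u, v + 1) ∈ hexagonPoints a b c →
      tilingHeight a b V u v - tilingHeight a b V u (v + 1) = indicator V ⟨.right, (u, v)⟩) := by
  induction n generalizing u v with
  | zero =>
    rw [mem_hexagonPoints] at h
    constructor <;> intro h1 <;> rw [mem_hexagonPoints] at h1 <;> push_cast at hn <;> omega
  | succ n ih =>
    push_cast at hn
    have h0 := mem_hexagonPoints.1 h
    refine ⟨fun h1 => ?_, fun h1 => ?_⟩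
    · have h1' := mem_hexagonPoints.1 h1
      by_cases hva : v = a
      -- The segment is on the boundary, so no lozenge inside the hexagon has it as a diagonal.
      · have : ¬ V ⟨.left, (u, v)⟩ := fun hL => by
          have := mem_hexagonPoints.1 (left_subset_hexagon.1 (hV.1 _ hL)).2.2.1
          omega
        rw [indicator_of_neg this, tilingHeight_bottom (Or.inr hva),
          tilingHeight_bottom (Or.inr hva), sub_zero]
      · have h2 : (u + 1, v + 1) ∈ hexagonPoints a b c := by
          rw [mem_hexagonPoints]
          omega
        have e1 := existsUnique_pointsLeft.1 (hV.2 _ (pointsLeft_mem_hexagon.2 ⟨h, h1, h2⟩))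
        have e2 := (ih (u + 1) v (by omega) h1).2 h2
        have e3 := tilingHeight_top_rule (V := V) (show u + 1 ≤ b by omega)
          (show v + 1 ≤ a by omega)
        omega
    · have h1' := mem_hexagonPoints.1 h1
      by_cases hub : u = b
      · have : ¬ V ⟨.right, (u, v)⟩ := fun hL => by
          have := mem_hexagonPoints.1 (right_subset_hexagon.1 (hV.1 _ hL)).2.2.1
          omega
        rw [indicator_of_neg this, tilingHeight_bottom (Or.inl hub),
          tilingHeight_bottom (Or.inl hub), sub_zero]
      · have h2 : (u + 1, v + 1) ∈ hexagonPoints a b c := by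
          rw [mem_hexagonPoints]
          omega
        have e1 := existsUnique_pointsRight.1 (hV.2 _ (pointsRight_mem_hexagon.2 ⟨h, h1, h2⟩))
        have e2 := (ih u (v + 1) (by omega) h1).1 h2
        have e3 := tilingHeight_top_rule (V := V) (show u + 1 ≤ b by omega)
          (show v + 1 ≤ a by omega)
        omega

theorem IsTiling.isHeightFunction {V : Lozenge → Prop} (hV : IsTiling a b c V) :
    IsHeightFunction a b c V (tilingHeight a b V) where
  subset := hV.1
  bottom _ _ _ hb := tilingHeight_bottom hb
  top_rule u v _ h := by
    rw [mem_hexagonPoints] at h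
    exact tilingHeight_top_rule (by omega) (by omega)
  left_rule u v h := (hV.side_rules _ u v (Int.self_le_toNat _) h).1
  right_rule u v h := (hV.side_rules _ u v (Int.self_le_toNat _) h).2

/-! ### Boundary values, bounds and uniqueness of height functions -/

namespace IsHeightFunction

variable {V : Lozenge → Prop} {h : ℤ → ℤ → ℤ}

/-- No lozenge in the hexagon has its diagonal on the boundary. Following the boundary from the
bottom, this fixes the heights on the left side, and then on the two upper sides. -/
theorem left_side (hh : IsHeightFunction a b c V h) (k : ℕ) (hk : k ≤ c) :
    h (b - k) (-k) = k := by
  induction k with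
  | zero => exact hh.bottom _ _ (by rw [mem_hexagonPoints]; omega) (by simp)
  | succ k ih =>
    have e1 : (b : ℤ) - (k + 1 : ℕ) + 1 = b - k := by push_cast; ring
    have e2 : -((k + 1 : ℕ) : ℤ) + 1 = -k := by push_cast; ring
    have e := hh.top_rule (b - (k + 1 : ℕ)) (-(k + 1 : ℕ)) (by rw [mem_hexagonPoints]; omega)
      (by rw [mem_hexagonPoints]; omega)
    rw [e1, e2, ih (by omega), indicator_of_neg] at e
    · push_cast at e ⊢
      omega
    · intro hL
      have := mem_hexagonPoints.1 (top_subset_hexagon.1 (hh.subset _ hL)).2.1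
      omega

theorem upper_left_side (hh : IsHeightFunction a b c V h) (k : ℕ) (hk : k ≤ b) :
    h (b - c - k) (-c) = c := by
  induction k with
  | zero => simpa using hh.left_side c le_rfl
  | succ k ih =>
    have e1 : (b : ℤ) - c - (k + 1 : ℕ) + 1 = b - c - k := by push_cast; ring
    have e := hh.left_rule (b - c - (k + 1 : ℕ)) (-c) (by rw [mem_hexagonPoints]; omega)
      (by rw [mem_hexagonPoints]; omega)
    rw [e1, ih (by omega), indicator_of_neg] at e
    · omega
    · intro hL
      have := mem_hexagonPoints.1 (left_subset_hexagon.1 (hh.subset _ hL)).2.2.2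
      omega

theorem upper_right_side (hh : IsHeightFunction a b c V h) (k : ℕ) (hk : k ≤ a) :
    h (-c) (-c + k) = c := by
  induction k with
  | zero => simpa using hh.upper_left_side b le_rfl
  | succ k ih =>
    have e1 : -(c : ℤ) + (k + 1 : ℕ) = -c + k + 1 := by push_cast; ring
    have e := hh.right_rule (-c) (-c + k) (by rw [mem_hexagonPoints]; omega)
      (by rw [mem_hexagonPoints]; omega)
    rw [ih (by omega), indicator_of_neg] at e
    · rw [e1]
      omega
    · intro hL
      have := mem_hexagonPoints.1 (right_subset_hexagon.1 (hh.subset _ hL)).2.2.2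
      omega

theorem upper_side (hh : IsHeightFunction a b c V h) {u v : ℤ}
    (hp : (u, v) ∈ hexagonPoints a b c) (huv : u = -c ∨ v = -c) : h u v = c := by
  rw [mem_hexagonPoints] at hp
  rcases huv with rfl | rfl
  · have := hh.upper_right_side (v + c).toNat (by omega)
    rwa [show -(c : ℤ) + (v + c).toNat = v by omega] at this
  · have := hh.upper_left_side (b - c - u).toNat (by omega)
    rwa [show (b : ℤ) - c - (b - c - u).toNat = u by omega] at this

/-- The surface point has coordinates (u + h, v + h, h); the bounds place it in the box. Going up, h
grows by 0 or 1 while u and v drop by 1. -/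
theorem lower_bounds (hh : IsHeightFunction a b c V h) :
    ∀ u v, (u, v) ∈ hexagonPoints a b c → 0 ≤ h u v ∧ u + h u v ≤ b ∧ v + h u v ≤ a := by
  refine hexagonPoints_induction_up (fun u v hp hb => ?_) fun u v hp hp' ih => ?_
  · rw [hh.bottom u v hp hb]
    rw [mem_hexagonPoints] at hp
    omega
  · have h1 := hh.top_rule u v hp hp'
    have h2 := indicator_nonneg V ⟨.top, (u + 1, v + 1)⟩
    have h3 := indicator_le_one V ⟨.top, (u + 1, v + 1)⟩
    omega

theorem upper_bounds (hh : IsHeightFunction a b c V h) :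
    ∀ u v, (u, v) ∈ hexagonPoints a b c → h u v ≤ c ∧ 0 ≤ u + h u v ∧ 0 ≤ v + h u v := by
  refine hexagonPoints_induction_down (fun u v hp hb => ?_) fun u v hp hp' ih => ?_
  · rw [hh.upper_side hp hb]
    rw [mem_hexagonPoints] at hp
    omega
  · have h1 := hh.top_rule u v hp hp'
    have h2 := indicator_nonneg V ⟨.top, (u + 1, v + 1)⟩
    have h3 := indicator_le_one V ⟨.top, (u + 1, v + 1)⟩
    omega

/-- Top lozenges fix all vertical increments, and every vertical line starts at height 0 on a lower
side. -/
theorem eq_of_tops {V' : Lozenge → Prop} {h' : ℤ → ℤ → ℤ} (hh : IsHeightFunction a b c V h)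
    (hh' : IsHeightFunction a b c V' h') (htop : ∀ q, V ⟨.top, q⟩ ↔ V' ⟨.top, q⟩) :
    ∀ u v, (u, v) ∈ hexagonPoints a b c → h u v = h' u v := by
  refine hexagonPoints_induction_up (fun u v hp hb => ?_) fun u v hp hp' ih => ?_
  · rw [hh.bottom u v hp hb, hh'.bottom u v hp hb]
  · have h1 := hh.top_rule u v hp hp'
    have h2 := hh'.top_rule u v hp hp'
    have h3 : indicator V ⟨.top, (u + 1, v + 1)⟩ = indicator V' ⟨.top, (u + 1, v + 1)⟩ := by
      by_cases hq : V ⟨.top, (u + 1, v + 1)⟩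
      · rw [indicator_of_pos hq, indicator_of_pos ((htop _).1 hq)]
      · rw [indicator_of_neg hq, indicator_of_neg (mt (htop _).2 hq)]
    omega

theorem imp_of_tops {V' : Lozenge → Prop} {h' : ℤ → ℤ → ℤ} (hh : IsHeightFunction a b c V h)
    (hh' : IsHeightFunction a b c V' h') (htop : ∀ q, V ⟨.top, q⟩ ↔ V' ⟨.top, q⟩) (L : Lozenge)
    (hL : V L) : V' L := by
  obtain ⟨k, u, v⟩ := L
  cases k
  · obtain ⟨h1, h2, -⟩ := left_subset_hexagon.1 (hh.subset _ hL)
    refine indicator_eq_one_iff.1 ?_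
    rw [← hh'.left_rule u v h1 h2, ← hh.eq_of_tops hh' htop u v h1,
      ← hh.eq_of_tops hh' htop _ _ h2, hh.left_rule u v h1 h2, indicator_of_pos hL]
  · exact (htop _).1 hL
  · obtain ⟨h1, h2, -⟩ := right_subset_hexagon.1 (hh.subset _ hL)
    refine indicator_eq_one_iff.1 ?_
    rw [← hh'.right_rule u v h1 h2, ← hh.eq_of_tops hh' htop u v h1,
      ← hh.eq_of_tops hh' htop _ _ h2, hh.right_rule u v h1 h2, indicator_of_pos hL]

/-- The top lozenges determine a tiling. -/
theorem iff_of_tops {V' : Lozenge → Prop} {h' : ℤ → ℤ → ℤ} (hh : IsHeightFunction a b c V h)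
    (hh' : IsHeightFunction a b c V' h') (htop : ∀ q, V ⟨.top, q⟩ ↔ V' ⟨.top, q⟩) (L : Lozenge) :
    V L ↔ V' L :=
  ⟨hh.imp_of_tops hh' htop L, hh'.imp_of_tops hh (fun q => (htop q).symm) L⟩

end IsHeightFunction

end Tilings

/-! ### The correspondence of tilings and plane partitions -/

namespace BoxedPlanePartition

variable {a b c : ℕ}

/-- The point `(x, y, z)` belongs to the pile of cubes or to the walls behind it. -/
def Solid (π : BoxedPlanePartition a b c) (x y z : ℤ) : Prop :=
  z ≤ c ∧ (x ≤ 0 ∨ y ≤ 0 ∨ z ≤ π.entry (x - 1).toNat (y - 1).toNat)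

theorem Solid.mono {π : BoxedPlanePartition a b c} {x y z x' y' z' : ℤ} (h : π.Solid x y z)
    (hx : x' ≤ x) (hy : y' ≤ y) (hz : z' ≤ z) : π.Solid x' y' z' := by
  obtain ⟨h1, h2⟩ := h
  have := π.entry_anti (show (x' - 1).toNat ≤ (x - 1).toNat by omega)
    (show (y' - 1).toNat ≤ (y - 1).toNat by omega)
  exact ⟨by omega, by omega⟩

theorem solid_succ_iff {π : BoxedPlanePartition a b c} {i j : ℕ} {z : ℤ} :
    π.Solid (i + 1) (j + 1) z ↔ z ≤ π.entry i j := by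
  have := π.entry_le_height i j
  rw [Solid, show ((i : ℤ) + 1 - 1).toNat = i by omega, show ((j : ℤ) + 1 - 1).toNat = j by omega]
  omega

open Classical in
/-- The `z`-coordinate of the surface of the pile over a lattice point. -/
noncomputable def surface (π : BoxedPlanePartition a b c) (u v : ℤ) : ℤ :=
  (Nat.findGreatest (fun k => π.Solid (u + k) (v + k) k) c : ℕ)

theorem surface_nonneg (π : BoxedPlanePartition a b c) (u v : ℤ) : 0 ≤ π.surface u v :=
  Int.natCast_nonneg _

theorem solid_zero (π : BoxedPlanePartition a b c) (x y : ℤ) : π.Solid x y 0 :=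
  ⟨by omega, by omega⟩

theorem solid_surface (π : BoxedPlanePartition a b c) (u v : ℤ) :
    π.Solid (u + π.surface u v) (v + π.surface u v) (π.surface u v) := by
  classical
  exact Nat.findGreatest_spec (P := fun k : ℕ => π.Solid (u + k) (v + k) k) (Nat.zero_le c)
    (π.solid_zero _ _)

/-- Solidity is inherited towards the floor and the walls, so on a line in direction (1, 1, 1) the
solid points with z ≥ 0 form an initial segment. -/
theorem le_surface_iff {π : BoxedPlanePartition a b c} {u v z : ℤ} (hz : 0 ≤ z) :
    z ≤ π.surface u v ↔ π.Solid (u + z) (v + z) z := by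
  classical
  refine ⟨fun h => (π.solid_surface u v).mono (by omega) (by omega) h, fun h => ?_⟩
  obtain ⟨k, rfl⟩ := Int.eq_ofNat_of_zero_le hz
  exact Int.ofNat_le.2 (Nat.le_findGreatest (P := fun k : ℕ => π.Solid (u + k) (v + k) k)
    (Int.ofNat_le.1 h.1) h)

theorem surface_eq {π : BoxedPlanePartition a b c} {u v z : ℤ} (hz : 0 ≤ z)
    (h1 : π.Solid (u + z) (v + z) z) (h2 : ¬ π.Solid (u + z + 1) (v + z + 1) (z + 1)) :
    π.surface u v = z := by
  refine le_antisymm ?_ ((le_surface_iff hz).2 h1)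
  by_contra hlt
  refine h2 ?_
  rw [add_assoc, add_assoc]
  exact (le_surface_iff (by omega)).1 (by omega)

theorem not_solid_surface (π : BoxedPlanePartition a b c) (u v : ℤ) :
    ¬ π.Solid (u + π.surface u v + 1) (v + π.surface u v + 1) (π.surface u v + 1) := by
  rw [add_assoc, add_assoc, ← le_surface_iff (by have := π.surface_nonneg u v; omega)]
  omega

theorem surface_bounds (π : BoxedPlanePartition a b c) {u v : ℤ}
    (hp : (u, v) ∈ hexagonPoints a b c) :
    0 ≤ u + π.surface u v ∧ 0 ≤ v + π.surface u v ∧ u + π.surface u v ≤ b ∧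
      v + π.surface u v ≤ a := by
  rw [mem_hexagonPoints] at hp
  have h0 := π.surface_nonneg u v
  have h1 : 0 ≤ u + π.surface u v := by
    by_contra hlt
    have := (le_surface_iff (π := π) (u := u) (v := v) (z := -u) (by omega)).2
      ⟨by omega, by omega⟩
    omega
  have h2 : 0 ≤ v + π.surface u v := by
    by_contra hlt
    have := (le_surface_iff (π := π) (u := u) (v := v) (z := -v) (by omega)).2
      ⟨by omega, by omega⟩
    omega
  obtain ⟨h3, h4⟩ := π.solid_surface u v
  refine ⟨h1, h2, ?_, ?_⟩
  · by_contra hlt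
    have := π.rows_le (u + π.surface u v - 1).toNat (v + π.surface u v - 1).toNat (by omega)
    omega
  · by_contra hlt
    have := π.cols_le (u + π.surface u v - 1).toNat (v + π.surface u v - 1).toNat (by omega)
    omega

theorem isVisible_top_iff {π : BoxedPlanePartition a b c} {u v : ℤ} :
    π.IsVisible ⟨.top, (u, v)⟩ ↔ ∃ i j : ℕ, i < b ∧ j < a ∧ u = i + 1 - π.entry i j ∧
      v = j + 1 - π.entry i j := by
  constructor
  · rintro (⟨i, j, hi, hj⟩ | _ | _)
    exact ⟨i, j, hi, hj, rfl, rfl⟩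
  · rintro ⟨i, j, hi, hj, rfl, rfl⟩
    exact .top i j hi hj

theorem isVisible_left_iff {π : BoxedPlanePartition a b c} {u v : ℤ} :
    π.IsVisible ⟨.left, (u, v)⟩ ↔ ∃ i j k : ℕ, i ≤ b ∧ j < a ∧ π.entry i j < k ∧
      k ≤ π.height i (j + 1) ∧ u = i - k ∧ v = j + 1 - k := by
  constructor
  · rintro (_ | ⟨i, j, k, hi, hj, hk, hk'⟩ | _)
    exact ⟨i, j, k, hi, hj, hk, hk', rfl, rfl⟩
  · rintro ⟨i, j, k, hi, hj, hk, hk', rfl, rfl⟩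
    exact .left i j k hi hj hk hk'

theorem isVisible_right_iff {π : BoxedPlanePartition a b c} {u v : ℤ} :
    π.IsVisible ⟨.right, (u, v)⟩ ↔ ∃ i j k : ℕ, i < b ∧ j ≤ a ∧ π.entry i j < k ∧
      k ≤ π.height (i + 1) j ∧ u = i + 1 - k ∧ v = j - k := by
  constructor
  · rintro (_ | _ | ⟨i, j, k, hi, hj, hk, hk'⟩)
    exact ⟨i, j, k, hi, hj, hk, hk', rfl, rfl⟩
  · rintro ⟨i, j, k, hi, hj, hk, hk', rfl, rfl⟩
    exact .right i j k hi hj hk hk'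

theorem height_succ_succ (π : BoxedPlanePartition a b c) (i j : ℕ) :
    π.height (i + 1) (j + 1) = π.entry i j := rfl

theorem le_height_iff {π : BoxedPlanePartition a b c} {i j k : ℕ} :
    k ≤ π.height i j ↔ π.Solid i j k := by
  rcases i with _ | i
  · simp [height, Solid]
  rcases j with _ | j
  · simp [height, Solid]
  · rw [height_succ_succ]
    push_cast
    rw [solid_succ_iff]
    omega

theorem surface_of_top {π : BoxedPlanePartition a b c} {u v : ℤ} {i j : ℕ}
    (hu : u = i + 1 - π.entry i j) (hv : v = j + 1 - π.entry i j) :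
    π.surface u v = π.entry i j := by
  have h := π.entry_anti (Nat.le_succ i) (Nat.le_succ j)
  refine surface_eq (by omega) ?_ ?_
  · rw [show u + π.entry i j = i + 1 by omega, show v + π.entry i j = j + 1 by omega,
      solid_succ_iff]
  · rw [show u + π.entry i j + 1 = (i + 1 : ℕ) + 1 by push_cast; omega,
      show v + π.entry i j + 1 = (j + 1 : ℕ) + 1 by push_cast; omega, solid_succ_iff]
    simp only [Nat.succ_eq_add_one] at h
    omega

theorem surface_of_left {π : BoxedPlanePartition a b c} {u v : ℤ} {i j k : ℕ}
    (hk : π.entry i j < k) (hk' : k ≤ π.height i (j + 1)) (hu : u = i - k) (hv : v = j + 1 - k) :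
    π.surface u v = k := by
  have h := π.row_anti i j
  rw [le_height_iff] at hk'
  refine surface_eq (by omega) ?_ ?_
  · rw [show u + k = i by omega, show v + k = (j + 1 : ℕ) by push_cast; omega]
    exact hk'
  · rw [show u + k + 1 = i + 1 by omega, show v + k + 1 = (j + 1 : ℕ) + 1 by push_cast; omega,
      solid_succ_iff]
    omega

theorem surface_of_right {π : BoxedPlanePartition a b c} {u v : ℤ} {i j k : ℕ}
    (hk : π.entry i j < k) (hk' : k ≤ π.height (i + 1) j) (hu : u = i + 1 - k) (hv : v = j - k) :
    π.surface u v = k := by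
  have h := π.col_anti i j
  rw [le_height_iff] at hk'
  refine surface_eq (by omega) ?_ ?_
  · rw [show u + k = (i + 1 : ℕ) by push_cast; omega, show v + k = j by omega]
    exact hk'
  · rw [show u + k + 1 = (i + 1 : ℕ) + 1 by push_cast; omega, show v + k + 1 = j + 1 by omega,
      solid_succ_iff]
    omega

/-- A face is seen exactly if the surface point leaves the pile when moved one unit along the normal
of the face. The same holds for the other two kinds. -/
theorem isVisible_top_iff_not_solid {π : BoxedPlanePartition a b c} {u v : ℤ}
    (hp : (u, v) ∈ hexagonPoints a b c) (hp' : (u - 1, v - 1) ∈ hexagonPoints a b c) :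
    π.IsVisible ⟨.top, (u, v)⟩ ↔
      ¬ π.Solid (u + π.surface u v) (v + π.surface u v) (π.surface u v + 1) := by
  rw [isVisible_top_iff]
  constructor
  · rintro ⟨i, j, -, -, hu, hv⟩
    rw [surface_of_top hu hv, show u + π.entry i j = i + 1 by omega,
      show v + π.entry i j = j + 1 by omega, solid_succ_iff]
    omega
  · intro h
    have h0 := π.surface_nonneg u v
    have hb := π.surface_bounds hp
    have hs := π.solid_surface u v
    rw [mem_hexagonPoints] at hp'
    -- On a back wall the point above would be solid unless the height is c, and that case is
    -- excluded by (u - 1, v - 1) lying in the hexagon.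
    have hpos : 1 ≤ u + π.surface u v ∧ 1 ≤ v + π.surface u v := by
      by_contra hn
      by_cases hc : π.surface u v + 1 ≤ c
      · exact h ⟨hc, by omega⟩
      · have := hs.1
        omega
    obtain ⟨i, hi⟩ := Int.eq_ofNat_of_zero_le (show 0 ≤ u + π.surface u v - 1 by omega)
    obtain ⟨j, hj⟩ := Int.eq_ofNat_of_zero_le (show 0 ≤ v + π.surface u v - 1 by omega)
    rw [show u + π.surface u v = i + 1 by omega, show v + π.surface u v = j + 1 by omega,
      solid_succ_iff] at h hs
    exact ⟨i, j, by omega, by omega, by omega, by omega⟩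

theorem isVisible_left_iff_not_solid {π : BoxedPlanePartition a b c} {u v : ℤ}
    (hp : (u, v) ∈ hexagonPoints a b c) :
    π.IsVisible ⟨.left, (u, v)⟩ ↔
      ¬ π.Solid (u + π.surface u v + 1) (v + π.surface u v) (π.surface u v) := by
  rw [isVisible_left_iff]
  constructor
  · rintro ⟨i, j, k, -, -, hk, hk', hu, hv⟩
    rw [surface_of_left hk hk' hu hv, show u + k + 1 = i + 1 by omega,
      show v + k = j + 1 by omega, solid_succ_iff]
    omega
  · intro h
    have h0 := π.surface_nonneg u v
    have hb := π.surface_bounds hp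
    have hs := π.solid_surface u v
    have hpos : 1 ≤ v + π.surface u v := by
      by_contra hn
      exact h ⟨hs.1, by omega⟩
    obtain ⟨k, hk⟩ := Int.eq_ofNat_of_zero_le h0
    rw [hk] at h hs hb hpos
    obtain ⟨i, hi⟩ := Int.eq_ofNat_of_zero_le (show 0 ≤ u + k by omega)
    obtain ⟨j, hj⟩ := Int.eq_ofNat_of_zero_le (show 0 ≤ v + k - 1 by omega)
    rw [show u + k = i by omega, show v + k = j + 1 by omega] at h hs
    rw [solid_succ_iff] at h
    refine ⟨i, j, k, by omega, by omega, by omega, ?_, by omega, by omega⟩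
    rw [le_height_iff]
    exact_mod_cast hs

theorem isVisible_right_iff_not_solid {π : BoxedPlanePartition a b c} {u v : ℤ}
    (hp : (u, v) ∈ hexagonPoints a b c) :
    π.IsVisible ⟨.right, (u, v)⟩ ↔
      ¬ π.Solid (u + π.surface u v) (v + π.surface u v + 1) (π.surface u v) := by
  rw [isVisible_right_iff]
  constructor
  · rintro ⟨i, j, k, -, -, hk, hk', hu, hv⟩
    rw [surface_of_right hk hk' hu hv, show u + k = i + 1 by omega,
      show v + k + 1 = j + 1 by omega, solid_succ_iff]
    omega
  · intro h
    have h0 := π.surface_nonneg u v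
    have hb := π.surface_bounds hp
    have hs := π.solid_surface u v
    have hpos : 1 ≤ u + π.surface u v := by
      by_contra hn
      exact h ⟨hs.1, by omega⟩
    obtain ⟨k, hk⟩ := Int.eq_ofNat_of_zero_le h0
    rw [hk] at h hs hb hpos
    obtain ⟨i, hi⟩ := Int.eq_ofNat_of_zero_le (show 0 ≤ u + k - 1 by omega)
    obtain ⟨j, hj⟩ := Int.eq_ofNat_of_zero_le (show 0 ≤ v + k by omega)
    rw [show u + k = i + 1 by omega, show v + k = j by omega] at h hs
    rw [solid_succ_iff] at h
    refine ⟨i, j, k, by omega, by omega, by omega, ?_, by omega, by omega⟩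
    rw [le_height_iff]
    exact_mod_cast hs

theorem isVisible_subset (π : BoxedPlanePartition a b c) (L : Lozenge) (hL : π.IsVisible L) :
    L.triangles ⊆ hexagon a b c := by
  obtain ⟨k, u, v⟩ := L
  cases k
  · obtain ⟨i, j, k, hi, hj, hk, hk', hu, hv⟩ := isVisible_left_iff.1 hL
    have := (le_height_iff.1 hk').1
    simp only [left_subset_hexagon, mem_hexagonPoints]
    omega
  · obtain ⟨i, j, hi, hj, hu, hv⟩ := isVisible_top_iff.1 hL
    have := π.entry_le_height i j
    simp only [top_subset_hexagon, mem_hexagonPoints]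
    omega
  · obtain ⟨i, j, k, hi, hj, hk, hk', hu, hv⟩ := isVisible_right_iff.1 hL
    have := (le_height_iff.1 hk').1
    simp only [right_subset_hexagon, mem_hexagonPoints]
    omega

/-- Heredity of solidity leaves two possible values for each increment, and the solidity test that
decides between them is the visibility test of the lozenge. -/
theorem isHeightFunction (π : BoxedPlanePartition a b c) :
    IsHeightFunction a b c π.IsVisible π.surface where
  subset := π.isVisible_subset
  bottom u v hp h := by
    have h1 := π.surface_bounds hp
    have h2 := π.surface_nonneg u v
    omega
  top_rule u v hp hp' := by
    have h0 := π.surface_nonneg (u + 1) (v + 1)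
    have hs := π.solid_surface (u + 1) (v + 1)
    have hn := π.not_solid_surface (u + 1) (v + 1)
    have hvis := isVisible_top_iff_not_solid (π := π) hp' (by simpa using hp)
    set s := π.surface (u + 1) (v + 1)
    have h1 : s ≤ π.surface u v :=
      (le_surface_iff h0).2 (hs.mono (by omega) (by omega) le_rfl)
    have h2 : ¬ s + 2 ≤ π.surface u v := fun h =>
      hn (((le_surface_iff (by omega)).1 h).mono (by omega) (by omega) (by omega))
    have h3 : s + 1 ≤ π.surface u v ↔ π.Solid (u + 1 + s) (v + 1 + s) (s + 1) := by
      rw [le_surface_iff (by omega), show u + (s + 1) = u + 1 + s by ring,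
        show v + (s + 1) = v + 1 + s by ring]
    by_cases h : π.Solid (u + 1 + s) (v + 1 + s) (s + 1)
    · rw [indicator_of_neg (fun h' => hvis.1 h' h)]
      have := h3.2 h
      omega
    · rw [indicator_of_pos (hvis.2 h)]
      have := mt h3.1 h
      omega
  left_rule u v hp hp' := by
    have h0 := π.surface_nonneg u v
    have hs := π.solid_surface u v
    have hn := π.not_solid_surface u v
    have hvis := isVisible_left_iff_not_solid (π := π) hp
    have hnn := π.surface_nonneg (u + 1) v
    set s := π.surface u v
    have h1 : s - 1 ≤ π.surface (u + 1) v := by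
      by_cases h : s = 0
      · omega
      · exact (le_surface_iff (by omega)).2 (hs.mono (by omega) (by omega) (by omega))
    have h2 : ¬ s + 1 ≤ π.surface (u + 1) v := fun h =>
      hn (((le_surface_iff (by omega)).1 h).mono (by omega) (by omega) (by omega))
    have h3 : s ≤ π.surface (u + 1) v ↔ π.Solid (u + s + 1) (v + s) s := by
      rw [le_surface_iff h0, add_right_comm]
    by_cases h : π.Solid (u + s + 1) (v + s) s
    · rw [indicator_of_neg (fun h' => hvis.1 h' h)]
      have := h3.2 h
      omega
    · rw [indicator_of_pos (hvis.2 h)]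
      have := mt h3.1 h
      omega
  right_rule u v hp hp' := by
    have h0 := π.surface_nonneg u v
    have hs := π.solid_surface u v
    have hn := π.not_solid_surface u v
    have hvis := isVisible_right_iff_not_solid (π := π) hp
    have hnn := π.surface_nonneg u (v + 1)
    set s := π.surface u v
    have h1 : s - 1 ≤ π.surface u (v + 1) := by
      by_cases h : s = 0
      · omega
      · exact (le_surface_iff (by omega)).2 (hs.mono (by omega) (by omega) (by omega))
    have h2 : ¬ s + 1 ≤ π.surface u (v + 1) := fun h =>
      hn (((le_surface_iff (by omega)).1 h).mono (by omega) (by omega) (by omega))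
    have h3 : s ≤ π.surface u (v + 1) ↔ π.Solid (u + s) (v + s + 1) s := by
      rw [le_surface_iff h0, add_right_comm]
    by_cases h : π.Solid (u + s) (v + s + 1) s
    · rw [indicator_of_neg (fun h' => hvis.1 h' h)]
      have := h3.2 h
      omega
    · rw [indicator_of_pos (hvis.2 h)]
      have := mt h3.1 h
      omega

/-- The lozenges determine the surface, and k ≤ `entry i j` says that the surface over the
projection of (i + 1, j + 1, k) reaches height k. -/
theorem eq_of_isVisible_iff {π π' : BoxedPlanePartition a b c}
    (h : ∀ L, π.IsVisible L ↔ π'.IsVisible L) : π = π' := by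
  have hs := π.isHeightFunction.eq_of_tops π'.isHeightFunction fun q => h _
  have key : ∀ (i j k : ℕ), i < b → j < a → (k ≤ π.entry i j ↔ k ≤ π'.entry i j) := by
    intro i j k hi hj
    by_cases hk : k ≤ c
    · have := hs (i + 1 - k) (j + 1 - k) (by rw [mem_hexagonPoints]; omega)
      rw [← Int.ofNat_le, ← Int.ofNat_le, ← solid_succ_iff, ← solid_succ_iff]
      have e1 := le_surface_iff (π := π) (u := i + 1 - k) (v := j + 1 - k) (Int.natCast_nonneg k)
      have e2 := le_surface_iff (π := π') (u := i + 1 - k) (v := j + 1 - k) (Int.natCast_nonneg k)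
      rw [sub_add_cancel, sub_add_cancel] at e1 e2
      rw [← e1, ← e2, this]
    · have := π.entry_le_height i j
      have := π'.entry_le_height i j
      omega
  exact ext_entry fun i j hi hj =>
    le_antisymm ((key i j _ hi hj).1 le_rfl) ((key i j _ hi hj).2 le_rfl)

end BoxedPlanePartition

/-! ### The pile of cubes recovered from a height function -/

namespace IsHeightFunction

variable {a b c : ℕ} {V : Lozenge → Prop} {h : ℤ → ℤ → ℤ}

/-- One step down a vertical line lowers the height by at most 1, so the inequality persists for
smaller k. -/
theorem diagonal_mono (hh : IsHeightFunction a b c V h) {i j k l : ℕ} (hi : i < b) (hj : j < a)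
    (hkl : k ≤ l) (hl : l ≤ c) (hle : (l : ℤ) ≤ h (i + 1 - l) (j + 1 - l)) :
    (k : ℤ) ≤ h (i + 1 - k) (j + 1 - k) := by
  induction l, hkl using Nat.le_induction with
  | base => exact hle
  | succ l hkl ih =>
    refine ih (by omega) ?_
    have e := hh.top_rule (i + 1 - (l + 1 : ℕ)) (j + 1 - (l + 1 : ℕ))
      (by rw [mem_hexagonPoints]; omega) (by rw [mem_hexagonPoints]; omega)
    rw [show (i : ℤ) + 1 - (l + 1 : ℕ) + 1 = i + 1 - l by push_cast; ring,
      show (j : ℤ) + 1 - (l + 1 : ℕ) + 1 = j + 1 - l by push_cast; ring] at e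
    have := indicator_nonneg V ⟨.top, ((i : ℤ) + 1 - l, (j : ℤ) + 1 - l)⟩
    push_cast at hle e
    omega

open Classical in
/-- The number of cubes over a unit square of the floor, recovered from the height function. -/
noncomputable def column (a b c : ℕ) (h : ℤ → ℤ → ℤ) (i j : ℕ) : ℕ :=
  if i < b ∧ j < a then Nat.findGreatest (fun k => (k : ℤ) ≤ h (i + 1 - k) (j + 1 - k)) c else 0

theorem column_le : ∀ i j, column a b c h i j ≤ c := by
  intro i j
  rw [column]
  split_ifs
  · exact Nat.findGreatest_le _
  · exact Nat.zero_le _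

theorem le_column_iff (hh : IsHeightFunction a b c V h) {i j k : ℕ} (hi : i < b) (hj : j < a)
    (hk : k ≤ c) : k ≤ column a b c h i j ↔ (k : ℤ) ≤ h (i + 1 - k) (j + 1 - k) := by
  classical
  rw [column, if_pos ⟨hi, hj⟩]
  constructor
  · intro hle
    refine hh.diagonal_mono hi hj hle (Nat.findGreatest_le c) ?_
    refine Nat.findGreatest_spec (P := fun k : ℕ => (k : ℤ) ≤ h (i + 1 - k) (j + 1 - k))
      (Nat.zero_le c) ?_
    exact (hh.lower_bounds _ _ (by rw [mem_hexagonPoints]; push_cast; omega)).1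
  · intro hle
    exact Nat.le_findGreatest (P := fun k : ℕ => (k : ℤ) ≤ h (i + 1 - k) (j + 1 - k)) hk hle

/-- The plane partition of a height function. -/
noncomputable def planePartition (hh : IsHeightFunction a b c V h) :
    BoxedPlanePartition a b c where
  entry := column a b c h
  row_anti i j := by
    by_cases hij : i < b ∧ j + 1 < a
    · have hc := column_le (a := a) (b := b) (c := c) (h := h) i (j + 1)
      rw [hh.le_column_iff hij.1 (by omega) hc]
      have h1 := (hh.le_column_iff hij.1 hij.2 hc).1 le_rfl
      set k := column a b c h i (j + 1)
      have e := hh.right_rule (i + 1 - k) (j + 1 - k) (by rw [mem_hexagonPoints]; omega)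
        (by rw [mem_hexagonPoints]; omega)
      rw [show (j : ℤ) + 1 - k + 1 = (j + 1 : ℕ) + 1 - k by push_cast; ring] at e
      have := indicator_nonneg V ⟨.right, ((i : ℤ) + 1 - k, (j : ℤ) + 1 - k)⟩
      omega
    · rw [column, if_neg hij]
      exact Nat.zero_le _
  col_anti i j := by
    by_cases hij : i + 1 < b ∧ j < a
    · have hc := column_le (a := a) (b := b) (c := c) (h := h) (i + 1) j
      rw [hh.le_column_iff (by omega) hij.2 hc]
      have h1 := (hh.le_column_iff hij.1 hij.2 hc).1 le_rfl
      set k := column a b c h (i + 1) j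
      have e := hh.left_rule (i + 1 - k) (j + 1 - k) (by rw [mem_hexagonPoints]; omega)
        (by rw [mem_hexagonPoints]; omega)
      rw [show (i : ℤ) + 1 - k + 1 = (i + 1 : ℕ) + 1 - k by push_cast; ring] at e
      have := indicator_nonneg V ⟨.left, ((i : ℤ) + 1 - k, (j : ℤ) + 1 - k)⟩
      omega
    · rw [column, if_neg hij]
      exact Nat.zero_le _
  entry_le := column_le 0 0
  rows_le i j hi := if_neg (by omega)
  cols_le i j hj := if_neg (by omega)

theorem planePartition_entry (hh : IsHeightFunction a b c V h) (i j : ℕ) :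
    hh.planePartition.entry i j = column a b c h i j := rfl

/-- A top lozenge marks a vertical segment on which the height does not rise, which is where k ≤ h
first fails on the line over a floor square. -/
theorem top_iff_isVisible (hh : IsHeightFunction a b c V h) (q : ℤ × ℤ) :
    V ⟨.top, q⟩ ↔ hh.planePartition.IsVisible ⟨.top, q⟩ := by
  obtain ⟨u, v⟩ := q
  rw [BoxedPlanePartition.isVisible_top_iff]
  simp only [planePartition_entry]
  constructor
  · intro hV
    obtain ⟨h1, -, -, h2⟩ := top_subset_hexagon.1 (hh.subset _ hV)
    have e := hh.top_rule (u - 1) (v - 1) h1 (by simpa using h2)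
    rw [sub_add_cancel, sub_add_cancel, indicator_of_pos hV] at e
    have b1 := hh.lower_bounds _ _ h2
    have b2 := hh.upper_bounds _ _ h1
    obtain ⟨k, hk⟩ := Int.eq_ofNat_of_zero_le b1.1
    obtain ⟨i, hi⟩ := Int.eq_ofNat_of_zero_le (show 0 ≤ u - 1 + k by omega)
    obtain ⟨j, hj⟩ := Int.eq_ofNat_of_zero_le (show 0 ≤ v - 1 + k by omega)
    have hib : i < b := by omega
    have hja : j < a := by omega
    have hkc : k ≤ c := by omega
    have hcol : column a b c h i j = k := by
      refine le_antisymm ?_ ?_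
      · by_contra hlt
        have hc := column_le (a := a) (b := b) (c := c) (h := h) i j
        have := (hh.le_column_iff hib hja (show k + 1 ≤ c by omega)).1 (by omega)
        rw [show (i : ℤ) + 1 - (k + 1 : ℕ) = u - 1 by push_cast; omega,
          show (j : ℤ) + 1 - (k + 1 : ℕ) = v - 1 by push_cast; omega] at this
        omega
      · rw [hh.le_column_iff hib hja hkc, show (i : ℤ) + 1 - k = u by omega,
          show (j : ℤ) + 1 - k = v by omega]
        omega
    exact ⟨i, j, hib, hja, by omega, by omega⟩
  · rintro ⟨i, j, hi, hj, hu, hv⟩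
    have hc := column_le (a := a) (b := b) (c := c) (h := h) i j
    have h1 := (hh.le_column_iff hi hj hc).1 le_rfl
    set k := column a b c h i j with hk
    rw [← hu, ← hv] at h1
    have hp : (u, v) ∈ hexagonPoints a b c := by rw [mem_hexagonPoints]; omega
    have hp' : (u - 1, v - 1) ∈ hexagonPoints a b c := by rw [mem_hexagonPoints]; omega
    have h2 : h (u - 1) (v - 1) ≤ k := by
      by_cases hkc : k + 1 ≤ c
      · have := mt (hh.le_column_iff hi hj hkc).2 (by omega)
        rw [show (i : ℤ) + 1 - (k + 1 : ℕ) = u - 1 by push_cast; omega,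
          show (j : ℤ) + 1 - (k + 1 : ℕ) = v - 1 by push_cast; omega] at this
        push_cast at this
        omega
      · have := (hh.upper_bounds _ _ hp').1
        omega
    have e := hh.top_rule (u - 1) (v - 1) hp' (by simpa using hp)
    rw [sub_add_cancel, sub_add_cancel] at e
    by_contra hV
    rw [indicator_of_neg hV] at e
    omega

theorem iff_isVisible (hh : IsHeightFunction a b c V h) (L : Lozenge) :
    V L ↔ hh.planePartition.IsVisible L :=
  hh.iff_of_tops hh.planePartition.isHeightFunction hh.top_iff_isVisible L

end IsHeightFunction

/-! ### Tilings of plane partitions and their corners -/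

namespace BoxedPlanePartition

variable {a b c : ℕ}

theorem finite_isVisible (π : BoxedPlanePartition a b c) : {L | π.IsVisible L}.Finite := by
  have hfin : ((fun p : LozengeKind × ℤ × ℤ => (⟨p.1, p.2⟩ : Lozenge)) ''
      (({.left, .top, .right} : Set LozengeKind) ×ˢ
        (Set.Icc (-(c : ℤ)) b ×ˢ Set.Icc (-(c : ℤ)) a))).Finite := by
    refine Set.Finite.image _ (Set.Finite.prod ?_ ((Set.finite_Icc _ _).prod (Set.finite_Icc _ _)))
    exact ((Set.finite_singleton _).insert _).insert _
  refine hfin.subset ?_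
  rintro ⟨k, u, v⟩ hL
  have hp : (u, v) ∈ hexagonPoints a b c := by
    have hs := π.isVisible_subset _ hL
    cases k
    · exact (left_subset_hexagon.1 hs).1
    · exact (top_subset_hexagon.1 hs).2.2.2
    · exact (right_subset_hexagon.1 hs).1
  rw [mem_hexagonPoints] at hp
  refine ⟨(k, u, v), ⟨by cases k <;> simp, Set.mem_Icc.2 ⟨by simp only; omega, by simp only; omega⟩,
    Set.mem_Icc.2 ⟨by simp only; omega, by simp only; omega⟩⟩, rfl⟩

/-- The lozenge tiling that is the picture of a plane partition. -/
noncomputable def tiling (π : BoxedPlanePartition a b c) : Finset Lozenge :=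
  π.finite_isVisible.toFinset

theorem mem_tiling {π : BoxedPlanePartition a b c} {L : Lozenge} :
    L ∈ π.tiling ↔ π.IsVisible L := by simp [tiling]

theorem tiling_injective : Function.Injective (tiling : BoxedPlanePartition a b c → _) :=
  fun π π' h => eq_of_isVisible_iff fun L => by rw [← mem_tiling, h, mem_tiling]

theorem range_tiling : Set.range (tiling : BoxedPlanePartition a b c → _) =
    lozengeTilings a b c := by
  ext T
  constructor
  · rintro ⟨π, rfl⟩
    have := π.isHeightFunction.isTiling
    exact ⟨fun L hL => this.1 L (mem_tiling.1 hL), fun t ht => by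
      simpa only [mem_tiling] using this.2 t ht⟩
  · intro hT
    have hT' : IsTiling a b c (· ∈ T) := hT
    refine ⟨hT'.isHeightFunction.planePartition, Finset.ext fun L => ?_⟩
    rw [mem_tiling]
    exact (hT'.isHeightFunction.iff_isVisible L).symm

/-- A tiling determines its pile, so the existentially quantified pile is π. -/
theorem hasHeight_tiling {π : BoxedPlanePartition a b c} {q : ℤ × ℤ} {h : ℕ} :
    HasHeight a b c π.tiling q h ↔ ∃ i j : ℕ, i < b ∧ j < a ∧
      q = proj (i + 1) (j + 1) (π.entry i j) ∧ π.entry i j = h := by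
  constructor
  · rintro ⟨π', h1, h2⟩
    obtain rfl : π = π' := eq_of_isVisible_iff fun L => by rw [← mem_tiling, h1]
    exact h2
  · exact fun h2 => ⟨π, fun L => mem_tiling, h2⟩

theorem isLeftCorner_tiling {π : BoxedPlanePartition a b c} {i j : ℕ} (hi : i < b) (hj : j < a) :
    IsLeftCorner π.tiling (proj (i + 1) (j + 1) (π.entry i j)) ↔
      π.entry (i + 1) j < π.entry i j := by
  rw [IsLeftCorner, mem_tiling, mem_tiling, and_iff_right (IsVisible.top i j hi hj), proj,
    isVisible_left_iff]
  constructor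
  · rintro ⟨i', j', k, -, -, hk, hk', hu, hv⟩
    -- The surface has one height over a lattice point, so both tiles are at the same height, and
    -- equal projections give the same cell.
    have h1 := surface_of_left hk hk' hu hv
    rw [surface_of_top rfl rfl] at h1
    obtain rfl : i' = i + 1 := by omega
    obtain rfl : j' = j := by omega
    omega
  · intro h
    exact ⟨i + 1, j, π.entry i j, hi, hj, h, le_rfl, by push_cast; ring, rfl⟩

theorem cornerCount_tiling (π : BoxedPlanePartition a b c) (ℓ : Fin c) :
    cornerCount a b c π.tiling ℓ = π.corners (ℓ + 1) := by
  rw [cornerCount, corners, ← Set.ncard_coe_finset]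
  symm
  -- At a fixed height the projection is injective on cells.
  refine Set.ncard_congr (fun p _ => proj (p.1 + 1) (p.2 + 1) (ℓ + 1)) ?_ ?_ ?_
  · rintro ⟨i, j⟩ hp
    simp only [Finset.coe_filter, Finset.mem_product, Finset.mem_range, Set.mem_ofPred_eq] at hp
    obtain ⟨⟨hi, hj⟩, h1, h2⟩ := hp
    have hq : proj ((i : ℤ) + 1) (j + 1) (ℓ + 1) = proj (i + 1) (j + 1) (π.entry i j) := by
      rw [h1]
      push_cast
      rfl
    refine ⟨?_, hasHeight_tiling.2 ⟨i, j, hi, hj, hq, h1⟩⟩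
    simp only [hq]
    exact (isLeftCorner_tiling hi hj).2 (by omega)
  · rintro ⟨i, j⟩ ⟨i', j'⟩ _ _ h
    simp only [proj, Prod.mk.injEq] at h ⊢
    omega
  · rintro q ⟨h1, h2⟩
    obtain ⟨i, j, hi, hj, rfl, h3⟩ := hasHeight_tiling.1 h2
    rw [isLeftCorner_tiling hi hj] at h1
    refine ⟨(i, j), ?_, ?_⟩
    · simp only [Finset.coe_filter, Finset.mem_product, Finset.mem_range, Set.mem_ofPred_eq]
      exact ⟨⟨hi, hj⟩, h3, by omega⟩
    · rw [h3]
      push_cast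
      rfl

end BoxedPlanePartition

/-! ### The generating function of a random tiling -/

/-- The generating function of a random variable `X` on the range of an injective map. -/
theorem hasSum_uniformOn_range {ι Ω Γ : Type*} [Fintype ι] [MeasurableSpace Ω]
    [DiscreteMeasurableSpace Ω] {f : ι → Ω} (hf : Function.Injective f) (X : Ω → Γ)
    (w : Γ → ℂ) :
    HasSum (fun γ => ((ProbabilityTheory.uniformOn (Set.range f)).real {ω | X ω = γ} : ℂ) * w γ)
      ((∑ i, w (X (f i))) / Fintype.card ι) := by
  classical
  have hreal : ∀ γ, (ProbabilityTheory.uniformOn (Set.range f)).real {ω | X ω = γ} =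
      (Finset.univ.filter fun i => X (f i) = γ).card / Fintype.card ι := by
    intro γ
    have hinter : Set.range f ∩ {ω | X ω = γ} =
        ((Finset.univ.filter fun i => X (f i) = γ).image f : Finset Ω) := by
      ext ω
      simp only [Set.mem_inter_iff, Set.mem_range, Set.mem_ofPred_eq, Finset.coe_image,
        Finset.coe_filter, Finset.mem_univ, true_and, Set.mem_image]
      constructor
      · rintro ⟨⟨i, rfl⟩, h⟩
        exact ⟨i, h, rfl⟩
      · rintro ⟨i, h, rfl⟩
        exact ⟨⟨i, rfl⟩, h⟩
    have hrange : Set.range f = (Finset.univ.image f : Finset Ω) := by simp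
    rw [MeasureTheory.measureReal_def, ProbabilityTheory.uniformOn,
      ProbabilityTheory.cond_apply MeasurableSet.of_discrete, hinter, hrange,
      MeasureTheory.Measure.count_apply_finset, MeasureTheory.Measure.count_apply_finset,
      Finset.card_image_of_injective _ hf, Finset.card_image_of_injective _ hf]
    simp [div_eq_inv_mul]
  have hsum : (∑ i, w (X (f i))) / Fintype.card ι =
      ∑ γ ∈ Finset.univ.image (fun i => X (f i)),
        ((ProbabilityTheory.uniformOn (Set.range f)).real {ω | X ω = γ} : ℂ) * w γ := by
    simp only [hreal]
    rw [Finset.sum_div, ← Finset.sum_fiberwise_of_maps_to (g := fun i => X (f i))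
      (fun i hi => Finset.mem_image_of_mem (fun i => X (f i)) hi)]
    refine Finset.sum_congr rfl fun γ _ => ?_
    rw [Finset.sum_congr rfl fun i hi => by rw [(Finset.mem_filter.1 hi).2], Finset.sum_const,
      nsmul_eq_mul]
    push_cast
    ring
  rw [hsum]
  -- Values that `X` does not take on the range of `f` have probability 0.
  refine hasSum_sum_of_ne_finset_zero fun γ hγ => ?_
  rw [hreal, Finset.filter_false_of_mem]
  · simp
  · intro i _ h
    exact hγ (Finset.mem_image.2 ⟨i, Finset.mem_univ i, h⟩)

/-- The joint probability generating function of the numbers of left corners of heights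
`1, …, c` in a uniformly random lozenge tiling of the hexagon. -/
theorem theorem5p1 (a b c : ℕ) (ha : 0 < a) (hb : 0 < b) (hc : 0 < c) (x : Fin c → ℂ) :
    HasSum
      (fun γ : Fin c → ℕ =>
        ((ProbabilityTheory.uniformOn (lozengeTilings a b c)).real
            {T | cornerCount a b c T = γ} : ℂ) *
          ∏ ℓ, x ℓ ^ γ ℓ)
      (normalizedSchur (rectangle a b) x (b + c)) ∧
    normalizedSchur (rectangle a b) x (b + c) =
      schur (rectangle a b) (Fin.append (fun _ : Fin b => 1) x) /
        schur (rectangle a b) (fun _ : Fin (b + c) => 1) := by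
  have hsymm : normalizedSchur (rectangle a b) x (b + c) =
      schur (rectangle a b) (Fin.append (fun _ : Fin b => 1) x) /
        schur (rectangle a b) (fun _ : Fin (b + c) => 1) := by
    rw [normalizedSchur, schur_append_ones, schur_ones_append]
  refine ⟨?_, hsymm⟩
  have hnum (y : Fin c → ℂ) : schur (rectangle a b) (Fin.append (fun _ : Fin b => 1) y) =
      ∑ π : BoxedPlanePartition a b c, ∏ ℓ, y ℓ ^ π.corners (ℓ + 1) := by
    rw [schur_ones_append, BoxedPlanePartition.sum_prod_corners_eq_strip hb]
  have hden : schur (rectangle a b) (fun _ : Fin (b + c) => 1) =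
      Fintype.card (BoxedPlanePartition a b c) := by
    -- With all variables 1, each plane partition has weight 1.
    have h := hnum fun _ => 1
    have e : (Fin.append (fun _ : Fin b => (1 : ℂ)) fun _ : Fin c => 1) = fun _ => 1 := by
      funext m
      refine Fin.addCases (fun i => ?_) (fun i => ?_) m <;> simp
    rw [e] at h
    simpa using h
  rw [hsymm, hnum, hden, ← BoxedPlanePartition.range_tiling]
  have : DiscreteMeasurableSpace (Finset Lozenge) := ⟨fun _ => trivial⟩
  have h := hasSum_uniformOn_range (BoxedPlanePartition.tiling_injective (a := a) (b := b) (c := c))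
    (cornerCount a b c) fun γ => ∏ ℓ, x ℓ ^ γ ℓ
  simpa only [BoxedPlanePartition.cornerCount_tiling] using h
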